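/- Let $T\ge 1$ and $N$ be natural numbers, let $R\in\mathbb R^{T\times N}$, $\hat\mu:=\frac1T R^\top\mathbf 1_T$, $\tau\ge 0$ and $\rho_1,\rho_2>0$. Put $$\tilde R:=(R,\,-\mathbf 1_T)\in\mathbb R^{T\times(N+1)},\quad \tilde I:=(I_N,\,\mathbf 0_N),\quad A:=\begin{pmatrix}\hat\mu^\top&-1\\ \mathbf 1_N^\top&0\end{pmatrix},\quad B:=\begin{pmatrix}\mathbf 0_N^\top&1\\ \mathbf 0_N^\top&-1\end{pmatrix},$$ $$D:=\begin{pmatrix}A\\-A\\B\end{pmatrix}\in\mathbb R^{6\times(N+1)},\qquad d:=(0,1,0,-1,\rho_1,-\rho_2)^\top,$$ $m_1:=N+1$, $m_2:=6$, $f(v):=\frac1T\|\tilde Rv\|_2^2$ and $g(v):=\tau\|\tilde Iv\|_1$ for $v\in\mathbb R^{m_1}$. Consider the problem $$\min_{v\in\mathbb R^{m_1}}\ f(v)+g(v)\quad\text{subject to}\quad Dv\ge d\ \text{ (componentwise)},\qquad(\ast)$$ and assume that its feasible set $\{v: Dv\ge d\}$ is nonempty. Let $L>0$ be a Lipschitz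 constant of $\nabla f$, that is, $\|\nabla f(x)-\nabla f(y)\|_2\le L\|x-y\|_2$ for all $x,y\in\mathbb R^{m_1}$. Let $\iota_d:\mathbb R^{m_2}\to\mathbb R\cup\{+\infty\}$ be $0$ on $\{x: x\ge d\}$ and $+\infty$ elsewhere, let $\psi^*(x):=\sup_u\{\langle x,u\rangle-\psi(u)\}$ denote the conjugate and $\mathrm{prox}_\psi(x):=\operatorname{argmin}_u\{\frac12\|u-x\|_2^2+\psi(u)\}$ the proximity operator of a function $\psi$. For $\beta,\eta>0$ and $z=(v,y)\in\mathbb R^{m_1}\times\mathbb R^{m_2}=\mathbb R^{m_1+m_2}$ let $r(z):=f(v)$, $\mathcal F(z):=(\mathrm{prox}_{\beta g}(v),\ \mathrm{prox}_{\eta\iota_d^*}(y))$, $$E:=\begin{pmatrix}I&-\beta D^\top\\ \eta D&I\end{pmatrix},\quad G:=\begin{pmatrix}I&-\beta D^\top\\ -\eta D&I\end{pmatrix},\quad W:=\begin{pmatrix}\frac1\beta I&-D^\top\\ -D&\frac1\eta I\end{pmatrix},$$ let $\mathcal T_G(z)$ be the unique $u\in\mathbb R^{m_1+m_2}$ with $u=\mathcal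 F((E-G)u+Gz)$, and let $\mathcal T_W(z):=\mathcal T_G(z-W^{-1}\nabla r(z))$. Let $\varrho\in(-1,1)$, $\delta>0$, $\theta_k:=\frac{\varrho k}{k+\delta}$ for $k=0,1,2,\dots$, and $\xi:=1-\max\{\varrho,0\}$. Suppose that $$\beta\in\Bigl(0,\frac{2\xi}{L}\Bigr)\quad\text{and}\quad \eta\in\Bigl(0,\ \frac{2\xi(2\xi-\beta L)}{4\beta\xi^2\|D\|_2^2+L(2\xi-\beta L)}\Bigr),$$ where $\|D\|_2$ is the spectral norm. Then for every initial vector $z^0\in\mathbb R^{m_1+m_2}$, the sequence defined by $$z^{k+1}=\mathcal T_Wz^k+\theta_k\,(\mathcal T_Wz^k-z^k),\qquad k=0,1,2,\dots,$$ has the property that the vectors $x^k:=(z^k_1,\dots,z^k_{m_1})^\top$ converge to a solution of $(\ast)$. -/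

import Mathlib

open Filter Topology Set
open scoped Matrix

namespace KMPA

noncomputable section

/-! ### Convex-analytic notions -/

/-- The set of minimizers of `u ↦ ½‖u - x‖² + ψ u`. -/
def proxSet {E : Type*} [NormedAddCommGroup E] (ψ : E → EReal) (x : E) : Set E :=
  {p | IsMinOn (fun u => ((1 / 2 * ‖u - x‖ ^ 2 : ℝ) : EReal) + ψ u) Set.univ p}

/-- The proximity operator `prox_ψ`. The minimizer exists and is unique for every proper lower
semicontinuous convex function `ψ` on a Euclidean space. -/
def prox {E : Type*} [NormedAddCommGroup E] (ψ : E → EReal) (x : E) : E :=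
  Classical.epsilon fun p => p ∈ proxSet ψ x

/-- The conjugate function `ψ*`. -/
def conj {E : Type*} [NormedAddCommGroup E] [InnerProductSpace ℝ E] (ψ : E → EReal) (x : E) :
    EReal :=
  ⨆ u : E, (((inner ℝ x u : ℝ) : EReal) - ψ u)

/-- The indicator function of `{x | x ≥ d}` (componentwise order). -/
def iota {n : Type*} (d : n → ℝ) (x : EuclideanSpace ℝ n) : EReal :=
  open Classical in if ∀ j, d j ≤ x j then 0 else ⊤

/-- A matrix acting on a Euclidean vector. -/
def app {m n : Type*} [Fintype n] (M : Matrix m n ℝ) (x : EuclideanSpace ℝ n) :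
    EuclideanSpace ℝ m :=
  WithLp.toLp 2 (M *ᵥ x.ofLp)

/-- The spectral norm `‖M‖₂`: the operator norm for the Euclidean norms. -/
def specNorm {m n : Type*} [Fintype m] [Fintype n] [DecidableEq n] (M : Matrix m n ℝ) : ℝ :=
  ‖LinearMap.toContinuousLinearMap (Matrix.toEuclideanLin M)‖

/-! ### Constrained minimization of `h v` subject to `D v ≥ d` -/

/-- The feasible set `{v | D v ≥ d}`. -/
def feasibleSet {m n : Type*} [Fintype m] (D : Matrix n m ℝ) (d : n → ℝ) :
    Set (EuclideanSpace ℝ m) :=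
  {v | ∀ j, d j ≤ app D v j}

/-- `v` minimizes `h` over `{v | D v ≥ d}`. -/
def IsSolution {m n : Type*} [Fintype m] (h : EuclideanSpace ℝ m → ℝ) (D : Matrix n m ℝ)
    (d : n → ℝ) (v : EuclideanSpace ℝ m) : Prop :=
  v ∈ feasibleSet D d ∧ IsMinOn h (feasibleSet D d) v

/-! ### The operators of the algorithm

A vector of `ℝ^(m₁ + m₂)` is indexed by the disjoint union `m ⊕ n` of the two index types, so that
its first `m₁` components are those indexed by `m` and its last `m₂` those indexed by `n`. -/

/-- The first block of components. -/
def fstBlock {m n : Type*} (z : EuclideanSpace ℝ (m ⊕ n)) : EuclideanSpace ℝ m :=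
  WithLp.toLp 2 fun i => z (Sum.inl i)

/-- The second block of components. -/
def sndBlock {m n : Type*} (z : EuclideanSpace ℝ (m ⊕ n)) : EuclideanSpace ℝ n :=
  WithLp.toLp 2 fun j => z (Sum.inr j)

/-- The vector with blocks `v` and `y`. -/
def stack {m n : Type*} (v : EuclideanSpace ℝ m) (y : EuclideanSpace ℝ n) :
    EuclideanSpace ℝ (m ⊕ n) :=
  WithLp.toLp 2 (Sum.elim v.ofLp y.ofLp)

section Operators

variable {m n : Type*} [Fintype m] [Fintype n] [DecidableEq m] [DecidableEq n]

/-- The matrix `E`. -/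
def matE (D : Matrix n m ℝ) (β η : ℝ) : Matrix (m ⊕ n) (m ⊕ n) ℝ :=
  Matrix.fromBlocks 1 (-(β • Dᵀ)) (η • D) 1

/-- The matrix `G`. -/
def matG (D : Matrix n m ℝ) (β η : ℝ) : Matrix (m ⊕ n) (m ⊕ n) ℝ :=
  Matrix.fromBlocks 1 (-(β • Dᵀ)) (-(η • D)) 1

/-- The matrix `W = P⁻¹ G`, where `P` is block diagonal with blocks `β I` and `η I`. -/
def matW (D : Matrix n m ℝ) (β η : ℝ) : Matrix (m ⊕ n) (m ⊕ n) ℝ :=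
  Matrix.fromBlocks ((1 / β) • 1) (-Dᵀ) (-D) ((1 / η) • 1)

/-- The function `r(v, y) = f(v)`. -/
def rFun (n : Type*) (f : EuclideanSpace ℝ m → ℝ) (z : EuclideanSpace ℝ (m ⊕ n)) : ℝ :=
  f (fstBlock z)

/-- The operator `𝓕(v, y) = (prox_{β g} v, prox_{η ι_d*} y)`. -/
def opF (g : EuclideanSpace ℝ m → ℝ) (d : n → ℝ) (β η : ℝ) (z : EuclideanSpace ℝ (m ⊕ n)) :
    EuclideanSpace ℝ (m ⊕ n) :=
  stack (prox (fun v => ((β * g v : ℝ) : EReal)) (fstBlock z))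
    (prox (fun y => (η : EReal) * conj (iota d) y) (sndBlock z))

/-- The operator `T_G`: `T_G z` is the vector `u` with `u = 𝓕((E - G) u + G z)`. -/
def opTG (g : EuclideanSpace ℝ m → ℝ) (D : Matrix n m ℝ) (d : n → ℝ) (β η : ℝ)
    (z : EuclideanSpace ℝ (m ⊕ n)) : EuclideanSpace ℝ (m ⊕ n) :=
  Classical.epsilon fun u =>
    u = opF g d β η (app (matE D β η - matG D β η) u + app (matG D β η) z)

/-- The operator `T_W = T_G ∘ (I - W⁻¹ ∇r)`. -/
def opTW (f g : EuclideanSpace ℝ m → ℝ) (D : Matrix n m ℝ) (d : n → ℝ) (β η : ℝ)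
    (z : EuclideanSpace ℝ (m ⊕ n)) : EuclideanSpace ℝ (m ⊕ n) :=
  opTG g D d β η (z - app (matW D β η)⁻¹ (gradient (rFun n f) z))

end Operators

/-- The momentum parameter `θ_k = ϱ k / (k + δ)`. -/
def theta (ϱ δ : ℝ) (k : ℕ) : ℝ :=
  ϱ * k / (k + δ)

/-! ### The portfolio model

The variable is `v = (w, ρ) ∈ ℝ^(N+1)`, with components indexed by `Fin N ⊕ Unit`. -/

/-- Index type of the `N + 1` components of `v = (w, ρ)`. -/
abbrev Var (N : ℕ) : Type := Fin N ⊕ Unit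

/-- Index type of the `6` inequality constraints. -/
abbrev Con : Type := (Fin 2 ⊕ Fin 2) ⊕ Fin 2

/-- The sample mean return vector `μ̂ = (1/T) Rᵀ 1`. -/
def meanReturn {T N : ℕ} (R : Matrix (Fin T) (Fin N) ℝ) : Fin N → ℝ :=
  (1 / (T : ℝ)) • (Rᵀ *ᵥ fun _ => 1)

/-- The matrix `R̃ = (R, -1)`. -/
def matR {T N : ℕ} (R : Matrix (Fin T) (Fin N) ℝ) : Matrix (Fin T) (Var N) ℝ :=
  Matrix.fromCols R (Matrix.of fun _ _ => -1)

/-- The matrix `Ĩ = (I, 0)`. -/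
def matI (N : ℕ) : Matrix (Fin N) (Var N) ℝ :=
  Matrix.fromCols 1 0

/-- The matrix `A`, with rows `(μ̂ᵀ, -1)` and `(1ᵀ, 0)`. -/
def matA {T N : ℕ} (R : Matrix (Fin T) (Fin N) ℝ) : Matrix (Fin 2) (Var N) ℝ :=
  Matrix.of ![Sum.elim (meanReturn R) fun _ => -1, Sum.elim (fun _ => 1) fun _ => 0]

/-- The matrix `B`, with rows `(0ᵀ, 1)` and `(0ᵀ, -1)`. -/
def matB (N : ℕ) : Matrix (Fin 2) (Var N) ℝ :=
  Matrix.of ![Sum.elim (fun _ => 0) fun _ => 1, Sum.elim (fun _ => 0) fun _ => -1]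

/-- The matrix `D`, obtained by stacking `A`, `-A` and `B`. -/
def matD {T N : ℕ} (R : Matrix (Fin T) (Fin N) ℝ) : Matrix Con (Var N) ℝ :=
  Matrix.fromRows (Matrix.fromRows (matA R) (-matA R)) (matB N)

/-- The vector `d`, obtained by stacking `b = (0, 1)`, `-b` and `c = (ρ₁, -ρ₂)`. -/
def vecd (ρ₁ ρ₂ : ℝ) : Con → ℝ :=
  Sum.elim (Sum.elim ![0, 1] (-![0, 1])) ![ρ₁, -ρ₂]

/-- The function `f(v) = (1/T) ‖R̃ v‖₂²`. -/
def fFun {T N : ℕ} (R : Matrix (Fin T) (Fin N) ℝ) (v : EuclideanSpace ℝ (Var N)) : ℝ :=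
  1 / (T : ℝ) * ‖app (matR R) v‖ ^ 2

/-- The function `g(v) = τ ‖Ĩ v‖₁`. -/
def gFun (N : ℕ) (τ : ℝ) (v : EuclideanSpace ℝ (Var N)) : ℝ :=
  τ * ∑ i, |app (matI N) v i|

end

end KMPA

/-! Since `E - G` has the single nonzero block `2ηD` below the diagonal, the implicit equation for
`T_G` can be solved block by block. Moreover `G = PW` with `P` block diagonal, so `G W⁻¹ ∇r` is `(β
∇f, 0)`. Hence `T_W` is an explicit primal-dual step: a soft thresholding of `v - β Dᵀy - β ∇f(v)`,
then a projection onto the nonpositive orthant at the extrapolated primal point. Its fixed points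
are exactly the pairs (feasible point, Lagrange multiplier).

The algorithm relaxes this step with factor `λ_k = 1 + θ_k`, which lies in `[1 + min ϱ 0, 2 - ξ]`.
Let `Q` be the quadratic form of `W` and `c = 1/β - η‖D‖²`. Firm nonexpansiveness of both proximity
operators and cocoercivity of `∇f` give, for every fixed point `p`, `Q(z_{k+1} - p) + λ_k (2 -
L/(2c) - λ_k) Q(T z_k - z_k) ≤ Q(z_k - p)` (`precondForm_step_le`). The step size conditions yield
`L < 2ξc`, so the middle coefficient is bounded below by a positive constant and `Q` is positive
definite. Fejér monotonicity then gives convergence to a fixed point (`exists_fixedPoint_tendsto`).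

This needs some fixed point to exist. The objective need not be coercive, but it is constant along
asymptotic directions of its sublevel sets, so a solution exists (`exists_isMinOn_polyhedron`).
Since the constraints are affine, Farkas' lemma provides a multiplier with no constraint
qualification. -/

namespace KMPA

/-! ### Attainment on polyhedra and Farkas' lemma -/

/-- A continuous function attains its minimum on a nonempty polyhedron if it is invariant along
every asymptotic direction of its sublevel sets. -/
theorem exists_isMinOn_polyhedron {E ι : Type*} [NormedAddCommGroup E] [InnerProductSpace ℝ E]
    [ProperSpace E] [Finite ι] (l : ι → E →L[ℝ] ℝ) (d : ι → ℝ) (h : E → ℝ) (hc : Continuous h)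
    (hrec : ∀ (v : ℕ → E) (u : E) (C : ℝ), Tendsto (fun k => ‖v k‖) atTop atTop →
      Tendsto (fun k => ‖v k‖⁻¹ • v k) atTop (𝓝 u) → (∀ k, h (v k) ≤ C) →
      ∀ (x : E) (t : ℝ), h (x + t • u) = h x)
    (x₀ : E) (hx₀ : ∀ j, d j ≤ l j x₀) :
    ∃ v, (∀ j, d j ≤ l j v) ∧ ∀ x, (∀ j, d j ≤ l j x) → h v ≤ h x := by
  set P : Set E := {x | ∀ j, d j ≤ l j x} with hP
  have hPc : IsClosed P := by
    have : P = ⋂ j, {x | d j ≤ l j x} := by ext; simp [hP]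
    rw [this]
    exact isClosed_iInter fun j => isClosed_le continuous_const (l j).continuous
  -- The points considered here include the least-norm minimizers over truncations of `P`. If they
  -- were unbounded, a limit `u` of their directions would allow the move `v - t u`, which keeps
  -- feasibility and the value of `h` but lowers the norm.
  have hbdd : ∃ K, ∀ v ∈ P, (∀ x ∈ P, ‖x‖ < ‖v‖ → h v < h x) → h v ≤ h x₀ → ‖v‖ ≤ K := by
    by_contra! hcon
    choose v hvP hvmin hvC hvK using fun k : ℕ => hcon (k + 1)
    have hpos : ∀ k, 0 < ‖v k‖ := fun k => lt_trans (by positivity) (hvK k)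
    obtain ⟨u, -, φ, hφ, hu⟩ := (isCompact_closedBall (0 : E) 1).tendsto_subseq
      (x := fun k => ‖v k‖⁻¹ • v k) (fun k => by
        simp [norm_smul, inv_mul_cancel₀ (hpos k).ne'])
    have hinf : Tendsto (fun k => ‖v (φ k)‖) atTop atTop := by
      refine tendsto_atTop_mono (fun k => ?_) tendsto_natCast_atTop_atTop
      have h1 : (k : ℝ) ≤ φ k := by exact_mod_cast hφ.id_le k
      linarith [hvK (φ k)]
    have hinv := hrec (v ∘ φ) u (h x₀) hinf hu (fun k => hvC _)
    have hun : ‖u‖ = 1 := by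
      refine tendsto_nhds_unique hu.norm (tendsto_const_nhds.congr fun k => ?_)
      simp [norm_smul, inv_mul_cancel₀ (hpos (φ k)).ne']
    have hlim : ∀ m : E →L[ℝ] ℝ, Tendsto (fun k => ‖v (φ k)‖⁻¹ * m (v (φ k))) atTop (𝓝 (m u)) :=
      fun m => ((m.continuous.tendsto u).comp hu).congr fun k => by simp
    have hlu : ∀ j, 0 ≤ l j u := fun j => by
      have h0 : Tendsto (fun k => ‖v (φ k)‖⁻¹ * d j) atTop (𝓝 (0 * d j)) :=
        hinf.inv_tendsto_atTop.mul_const _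
      rw [zero_mul] at h0
      exact le_of_tendsto_of_tendsto' h0 (hlim (l j)) fun k =>
        mul_le_mul_of_nonneg_left (hvP (φ k) j) (by positivity)
    have hgt : ∀ (m : E →L[ℝ] ℝ) (c : ℝ), 0 < m u → ∀ᶠ k in atTop, c < m (v (φ k)) := by
      intro m c hm
      have := (hinf.atTop_mul_pos hm (hlim m)).eventually_gt_atTop c
      filter_upwards [this] with k hk
      rwa [← mul_assoc, mul_inv_cancel₀ (hpos _).ne', one_mul] at hk
    -- Constraints increasing along `u` are eventually slack; the others have `l j u = 0` and are
    -- unaffected by moving along `u`.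
    have h1 : ∀ᶠ k in atTop, ∀ j, 0 < l j u → d j < l j (v (φ k)) := by
      rw [eventually_all]
      intro j
      by_cases hj : 0 < l j u
      · filter_upwards [hgt (l j) (d j) hj] with k hk _ using hk
      · exact Eventually.of_forall fun k hk => absurd hk hj
    have h2 : ∀ᶠ k in atTop, 0 < inner ℝ u (v (φ k)) := by
      have := hgt (innerSL ℝ u) 0 (by simp [hun])
      simpa using this
    obtain ⟨k, hk1, hk2⟩ := (h1.and h2).exists
    set w := v (φ k)
    have h3 : ∀ᶠ t in 𝓝[>] (0 : ℝ), ∀ j, d j ≤ l j (w + (-t) • u) := by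
      rw [eventually_all]
      intro j
      rcases (hlu j).eq_or_lt with hj | hj
      · refine Eventually.of_forall fun t => ?_
        simpa [← hj] using hvP (φ k) j
      · have hcont : Tendsto (fun t : ℝ => l j (w + (-t) • u)) (𝓝 0) (𝓝 (l j w)) := by
          have : Continuous fun t : ℝ => l j (w + (-t) • u) := by fun_prop
          simpa using this.tendsto 0
        exact nhdsWithin_le_nhds ((hcont.eventually (lt_mem_nhds (hk1 j hj))).mono
          fun t ht => ht.le)
    have h4 : ∀ᶠ t in 𝓝[>] (0 : ℝ), ‖w + (-t) • u‖ < ‖w‖ := by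
      have hlt : ∀ᶠ t in 𝓝[>] (0 : ℝ), t < 2 * inner ℝ u w :=
        nhdsWithin_le_nhds (gt_mem_nhds (by positivity))
      filter_upwards [hlt, self_mem_nhdsWithin] with t ht (ht0 : 0 < t)
      refine lt_of_pow_lt_pow_left₀ 2 (norm_nonneg _) ?_
      rw [norm_add_sq_real, norm_smul, hun, inner_smul_right, real_inner_comm]
      simp only [norm_neg, Real.norm_eq_abs, mul_one, sq_abs]
      nlinarith
    obtain ⟨t, ht3, ht4⟩ := (h3.and h4).exists
    exact lt_irrefl _ ((hvmin (φ k) _ ht3 ht4).trans_eq (hinv w (-t)))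
  obtain ⟨K, hK⟩ := hbdd
  -- Minimize over the truncation to radius `r`, then take the minimizer of least norm; the bound
  -- `K` on it does not depend on `r`.
  have hsel : ∀ r, ‖x₀‖ ≤ r → ∃ v ∈ P, ‖v‖ ≤ K ∧ ∀ x ∈ P, ‖x‖ ≤ r → h v ≤ h x := by
    intro r hr
    have hcpt : IsCompact (P ∩ Metric.closedBall 0 r) :=
      (isCompact_closedBall _ _).inter_left hPc
    obtain ⟨a, ha, hamin⟩ := hcpt.exists_isMinOn ⟨x₀, hx₀, by simpa using hr⟩ hc.continuousOn
    have hcpt' : IsCompact ((P ∩ Metric.closedBall 0 r) ∩ {x | h x ≤ h a}) :=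
      hcpt.inter_right (isClosed_le hc continuous_const)
    obtain ⟨b, hb, hbmin⟩ := hcpt'.exists_isMinOn ⟨a, ha, le_refl (h a)⟩ continuous_norm.continuousOn
    have hbr : ‖b‖ ≤ r := by simpa using hb.1.2
    have hmin : ∀ x ∈ P, ‖x‖ ≤ r → h b ≤ h x := fun x hx hxr =>
      le_trans hb.2 (hamin ⟨hx, by simpa using hxr⟩)
    refine ⟨b, hb.1.1, hK b hb.1.1 (fun x hx hxb => ?_) (hmin _ hx₀ hr), hmin⟩
    by_contra! hle
    have : ‖b‖ ≤ ‖x‖ := hbmin ⟨⟨hx, by simpa using hxb.le.trans hbr⟩, hle.trans hb.2⟩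
    linarith
  obtain ⟨v, hvP, hvK, hv⟩ := hsel (max ‖x₀‖ K) (le_max_left _ _)
  refine ⟨v, hvP, fun x hx => ?_⟩
  obtain ⟨w, hwP, hwK, hw⟩ := hsel (max ‖x₀‖ ‖x‖) (le_max_left _ _)
  exact (hv w hwP (hwK.trans (le_max_right _ _))).trans (hw x hx (le_max_right _ _))

/-- **Farkas' lemma** for finitely many linear functionals. -/
theorem exists_nonneg_sum_smul_eq {E ι : Type*} [NormedAddCommGroup E] [InnerProductSpace ℝ E]
    [Fintype ι] (a : ι → E) (c : E)
    (h : ∀ u, (∀ i, 0 ≤ inner ℝ (a i) u) → 0 ≤ inner ℝ c u) :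
    ∃ w : ι → ℝ, (∀ i, 0 ≤ w i) ∧ c = ∑ i, w i • a i := by
  classical
  set S : EuclideanSpace ℝ ι →L[ℝ] E :=
    ∑ i, (EuclideanSpace.proj i : EuclideanSpace ℝ ι →L[ℝ] ℝ).smulRight (a i) with hS
  have hSa : ∀ x, S x = ∑ i, x i • a i := fun x => by simp [hS]
  obtain ⟨w, hw0, hwmin⟩ := exists_isMinOn_polyhedron
    (fun i => (EuclideanSpace.proj i : EuclideanSpace ℝ ι →L[ℝ] ℝ)) (fun _ => 0)
    (fun x => ‖S x - c‖) (by fun_prop) (by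
      intro v u C hinf hu hC x t
      have hS0 : S u = 0 := by
        have h1 : Tendsto (fun k => S (‖v k‖⁻¹ • v k)) atTop (𝓝 (S u)) :=
          (S.continuous.tendsto u).comp hu
        have h2 : Tendsto (fun k => S (‖v k‖⁻¹ • v k)) atTop (𝓝 0) := by
          refine squeeze_zero_norm (a := fun k => ‖v k‖⁻¹ * (C + ‖c‖)) (fun k => ?_) ?_
          · rw [map_smul, norm_smul, norm_inv, norm_norm]
            refine mul_le_mul_of_nonneg_left ?_ (by positivity)
            have := norm_le_norm_sub_add (S (v k)) c
            linarith [hC k]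
          · simpa using hinf.inv_tendsto_atTop.mul_const (C + ‖c‖)
        exact tendsto_nhds_unique h1 h2
      simp [hS0]) 0 (by simp)
  replace hw0 : ∀ i, 0 ≤ w i := hw0
  replace hwmin : ∀ x : EuclideanSpace ℝ ι, (∀ i, 0 ≤ x i) → ‖S w - c‖ ≤ ‖S x - c‖ := hwmin
  set r := S w - c with hr
  -- First-order optimality of the nonnegative least-squares solution `w`. Restricting to `t ≤ 1`
  -- admits the direction `-w`. The directions `e_i` and `-w` give `⟨c, r⟩ ≥ 0` and `⟨r, S w⟩ ≤ 0`,
  -- hence `‖r‖² ≤ 0`.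
  have hdir : ∀ x, (∀ t : ℝ, 0 < t → t ≤ 1 → ∀ i, 0 ≤ (w + t • x) i) →
      0 ≤ inner ℝ r (S x) := by
    intro x hx
    by_contra! hneg
    have hev : ∀ t : ℝ, 0 < t → t ≤ 1 → 0 ≤ 2 * inner ℝ r (S x) + t * ‖S x‖ ^ 2 := by
      intro t ht ht'
      have h1 := hwmin _ (hx t ht ht')
      have h2 : S (w + t • x) - c = r + t • S x := by rw [hr]; simp; abel
      rw [h2] at h1
      have h3 : ‖r‖ ^ 2 ≤ ‖r + t • S x‖ ^ 2 := by gcongr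
      rw [norm_add_sq_real, inner_smul_right, norm_smul, mul_pow, Real.norm_eq_abs, sq_abs] at h3
      have : 0 ≤ t * (2 * inner ℝ r (S x) + t * ‖S x‖ ^ 2) := by nlinarith
      exact nonneg_of_mul_nonneg_right this ht
    have hlim : Tendsto (fun t : ℝ => 2 * inner ℝ r (S x) + t * ‖S x‖ ^ 2) (𝓝[>] 0)
        (𝓝 (2 * inner ℝ r (S x) + 0 * ‖S x‖ ^ 2)) := by
      refine Tendsto.mono_left (Continuous.tendsto ?_ 0) nhdsWithin_le_nhds
      fun_prop
    have := ge_of_tendsto hlim (by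
      filter_upwards [self_mem_nhdsWithin, nhdsWithin_le_nhds (Iic_mem_nhds one_pos)] with t ht ht'
      exact hev t ht ht')
    linarith
  have hpos : 0 ≤ inner ℝ c r := by
    refine h r fun i => ?_
    have := hdir (EuclideanSpace.single i 1) fun t ht _ j => by
      have := hw0 j
      by_cases hij : j = i <;> simp [hij] <;> first | (subst hij; linarith) | linarith
    rw [hSa] at this
    simpa [PiLp.single_apply, ite_smul, real_inner_comm] using this
  have hneg : 0 ≤ inner ℝ r (S (-w)) := hdir _ fun t ht ht' j => by
    have := hw0 j
    simp only [PiLp.add_apply, PiLp.smul_apply, PiLp.neg_apply, smul_eq_mul]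
    nlinarith
  have hr0 : r = 0 := by
    have h1 : inner ℝ r r = inner ℝ r (S w) - inner ℝ r c := by rw [← inner_sub_right]
    rw [map_neg, inner_neg_right] at hneg
    rw [real_inner_comm] at hpos
    exact real_inner_self_nonpos.1 (by linarith)
  refine ⟨w, hw0, ?_⟩
  rw [← hSa]
  exact (sub_eq_zero.1 hr0).symm

/-! ### Fejér monotone convergence -/

/-- Fejér monotone convergence of a relaxed fixed point iteration. -/
theorem exists_fixedPoint_tendsto {E : Type*} [NormedAddCommGroup E] [ProperSpace E]
    (Q : E → ℝ) (hQ : Continuous Q) (hQ0 : Q 0 = 0) (c : ℝ) (hc : 0 < c)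
    (hcQ : ∀ x, c * ‖x‖ ^ 2 ≤ Q x) (T : E → E) (hT : Continuous T) (ε : ℝ) (hε : 0 < ε)
    (z : ℕ → E)
    (hz : ∀ p, T p = p → ∀ k, Q (z (k + 1) - p) + ε * Q (T (z k) - z k) ≤ Q (z k - p))
    (p₀ : E) (hp₀ : T p₀ = p₀) : ∃ p, T p = p ∧ Tendsto z atTop (𝓝 p) := by
  have hQn : ∀ x, 0 ≤ Q x := fun x => le_trans (by positivity) (hcQ x)
  have hanti : ∀ p, T p = p → Antitone fun k => Q (z k - p) := fun p hp =>
    antitone_nat_of_succ_le fun k => by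
      linarith [hz p hp k, mul_nonneg hε.le (hQn (T (z k) - z k))]
  have hconv : ∀ p, T p = p → ∃ a, Tendsto (fun k => Q (z k - p)) atTop (𝓝 a) := fun p hp =>
    ⟨_, tendsto_atTop_ciInf (hanti p hp) ⟨0, by rintro _ ⟨k, rfl⟩; exact hQn _⟩⟩
  have hnorm : ∀ y : ℕ → E, Tendsto (fun k => Q (y k)) atTop (𝓝 0) → Tendsto y atTop (𝓝 0) := by
    intro y hy
    rw [tendsto_zero_iff_norm_tendsto_zero]
    have h1 : Tendsto (fun k => ‖y k‖ ^ 2) atTop (𝓝 0) := by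
      refine squeeze_zero (fun k => by positivity) (fun k => ?_)
        (by simpa using hy.const_mul c⁻¹)
      rw [← div_eq_inv_mul, le_div_iff₀ hc, mul_comm]
      exact hcQ _
    have := (Real.continuous_sqrt.tendsto 0).comp h1
    simpa [Function.comp_def, Real.sqrt_sq] using this
  obtain ⟨a, ha⟩ := hconv p₀ hp₀
  have hres : Tendsto (fun k => T (z k) - z k) atTop (𝓝 0) := by
    refine hnorm _ ?_
    have h1 : Tendsto (fun k => ε⁻¹ * (Q (z k - p₀) - Q (z (k + 1) - p₀))) atTop
        (𝓝 (ε⁻¹ * (a - a))) := (ha.sub (ha.comp (tendsto_add_atTop_nat 1))).const_mul _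
    rw [sub_self, mul_zero] at h1
    refine squeeze_zero (fun k => hQn _) (fun k => ?_) h1
    rw [← div_eq_inv_mul, le_div_iff₀ hε, mul_comm]
    linarith [hz p₀ hp₀ k]
  have hbd : ∀ k, z k ∈ Metric.closedBall p₀ (Real.sqrt (c⁻¹ * Q (z 0 - p₀))) := fun k => by
    rw [mem_closedBall_iff_norm]
    refine Real.le_sqrt_of_sq_le ?_
    rw [← div_eq_inv_mul, le_div_iff₀ hc, mul_comm]
    exact (hcQ _).trans (hanti p₀ hp₀ (Nat.zero_le k))
  -- A cluster point is fixed because the residuals vanish. The monotone sequence `Q (z k - p)` then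
  -- tends to zero along a subsequence, hence entirely.
  obtain ⟨p, -, φ, hφ, hp⟩ := (isCompact_closedBall _ _).tendsto_subseq hbd
  have hTp : T p = p := by
    have h1 := (hres.comp hφ.tendsto_atTop).add hp
    simp only [Function.comp_def, sub_add_cancel, zero_add] at h1
    exact tendsto_nhds_unique ((hT.tendsto p).comp hp) h1
  refine ⟨p, hTp, ?_⟩
  obtain ⟨b, hb⟩ := hconv p hTp
  have hb0 : b = 0 := by
    refine tendsto_nhds_unique (hb.comp hφ.tendsto_atTop) ?_
    have : Tendsto (fun k => Q (z (φ k) - p)) atTop (𝓝 (Q (p - p))) :=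
      (hQ.tendsto _).comp (hp.sub_const p)
    rwa [sub_self, hQ0] at this
  have := (hnorm _ (hb0 ▸ hb)).add_const p
  simpa using this

/-! ### The relaxed primal-dual iteration in the metric of the preconditioner -/

/-- Two points characterised by the variational inequality of a proximity operator are related by
firm nonexpansiveness. -/
theorem inner_nonneg_of_variational {X : Type*} [NormedAddCommGroup X] [InnerProductSpace ℝ X]
    {g : X → ℝ} {c : ℝ} {x x' u u' : X} (h : inner ℝ (x - u) (u' - u) ≤ c * (g u' - g u))
    (h' : inner ℝ (x' - u') (u - u') ≤ c * (g u - g u')) :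
    0 ≤ inner ℝ (x - x' - (u - u')) (u - u') := by
  have h1 : inner ℝ (x - x' - (u - u')) (u - u') =
      -inner ℝ (x - u) (u' - u) - inner ℝ (x' - u') (u - u') := by
    rw [← inner_neg_right, neg_sub, ← inner_sub_left]
    congr 1
    abel
  rw [h1]
  linarith

/-- The quadratic form of the preconditioner of the primal-dual iteration. -/
noncomputable def precondForm {X Y : Type*} [NormedAddCommGroup X] [InnerProductSpace ℝ X]
    [NormedAddCommGroup Y] [InnerProductSpace ℝ Y] (D : X →L[ℝ] Y) (β η : ℝ) (z : X × Y) : ℝ :=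
  ‖z.1‖ ^ 2 / β - 2 * inner ℝ (D z.1) z.2 + ‖z.2‖ ^ 2 / η

section PrimalDual

variable {X Y : Type*} [NormedAddCommGroup X] [InnerProductSpace ℝ X]
  [NormedAddCommGroup Y] [InnerProductSpace ℝ Y]

/-- Cauchy–Schwarz bounds the cross term, and completing the square in `‖z.2‖` eliminates the second
block. -/
theorem norm_fst_sq_le_precondForm (D : X →L[ℝ] Y) {β η : ℝ} (hη : 0 < η) (z : X × Y) :
    (1 / β - η * ‖D‖ ^ 2) * ‖z.1‖ ^ 2 ≤ precondForm D β η z := by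
  have h1 : inner ℝ (D z.1) z.2 ≤ ‖D‖ * ‖z.1‖ * ‖z.2‖ :=
    (real_inner_le_norm _ _).trans (by gcongr; exact D.le_opNorm _)
  have h2 : 0 ≤ (η * (‖D‖ * ‖z.1‖) - ‖z.2‖) ^ 2 / η := by positivity
  have h3 : (η * (‖D‖ * ‖z.1‖) - ‖z.2‖) ^ 2 / η =
      η * ‖D‖ ^ 2 * ‖z.1‖ ^ 2 - 2 * (‖D‖ * ‖z.1‖ * ‖z.2‖) + ‖z.2‖ ^ 2 / η := by
    field_simp
    ring
  have h4 : ‖z.1‖ ^ 2 / β = 1 / β * ‖z.1‖ ^ 2 := by ring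
  rw [precondForm, h4]
  linarith

theorem norm_snd_sq_le_precondForm (D : X →L[ℝ] Y) {β η : ℝ} (hβ : 0 < β) (z : X × Y) :
    (1 / η - β * ‖D‖ ^ 2) * ‖z.2‖ ^ 2 ≤ precondForm D β η z := by
  have h1 : inner ℝ (D z.1) z.2 ≤ ‖D‖ * ‖z.1‖ * ‖z.2‖ :=
    (real_inner_le_norm _ _).trans (by gcongr; exact D.le_opNorm _)
  have h2 : 0 ≤ (β * (‖D‖ * ‖z.2‖) - ‖z.1‖) ^ 2 / β := by positivity
  have h3 : (β * (‖D‖ * ‖z.2‖) - ‖z.1‖) ^ 2 / β =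
      β * ‖D‖ ^ 2 * ‖z.2‖ ^ 2 - 2 * (‖D‖ * ‖z.1‖ * ‖z.2‖) + ‖z.1‖ ^ 2 / β := by
    field_simp
    ring
  have h4 : ‖z.2‖ ^ 2 / η = 1 / η * ‖z.2‖ ^ 2 := by ring
  rw [precondForm, h4]
  linarith

theorem exists_mul_norm_sq_le_precondForm (D : X →L[ℝ] Y) {β η : ℝ} (hβ : 0 < β) (hη : 0 < η)
    (h : η * ‖D‖ ^ 2 < 1 / β) :
    ∃ c, 0 < c ∧ ∀ z, c * ‖z‖ ^ 2 ≤ precondForm D β η z := by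
  have h' : β * ‖D‖ ^ 2 < 1 / η := by
    rw [lt_div_iff₀ hβ] at h
    rw [lt_div_iff₀ hη]
    linarith
  refine ⟨min (1 / β - η * ‖D‖ ^ 2) (1 / η - β * ‖D‖ ^ 2),
    lt_min (by linarith) (by linarith), fun z => ?_⟩
  rw [Prod.norm_def]
  rcases max_choice ‖z.1‖ ‖z.2‖ with hm | hm <;> rw [hm]
  · exact le_trans (by gcongr; exact min_le_left _ _) (norm_fst_sq_le_precondForm D hη z)
  · exact le_trans (by gcongr; exact min_le_right _ _) (norm_snd_sq_le_precondForm D hβ z)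

/-- One relaxed step of the primal-dual iteration, expressed through the differences to a fixed
point. -/
theorem precondForm_step_le (D : X →L[ℝ] Y) {β η L c lam ε : ℝ} (hβ : 0 < β)
    (hη : 0 < η) (hL : 0 < L) (hc : c = 1 / β - η * ‖D‖ ^ 2) (hc0 : 0 < c) (hlam : 0 < lam)
    (hε : ε ≤ lam * (2 - L / (2 * c) - lam)) (A e Δ G : X) (B f : Y)
    (hG : ∀ x, inner ℝ G x = inner ℝ (D x) B)
    (h1 : 0 ≤ inner ℝ (A - β • G - β • Δ - e) e)
    (h2 : 0 ≤ inner ℝ (B + η • D ((2 : ℝ) • e - A) - f) f)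
    (h3 : ‖Δ‖ ^ 2 ≤ L * inner ℝ Δ A) :
    precondForm D β η (A + lam • (e - A), B + lam • (f - B)) +
      ε * precondForm D β η (e - A, f - B) ≤ precondForm D β η (A, B) := by
  have hq : c * ‖e - A‖ ^ 2 ≤ precondForm D β η (e - A, f - B) :=
    hc ▸ norm_fst_sq_le_precondForm D hη (e - A, f - B)
  have hq0 : 0 ≤ precondForm D β η (e - A, f - B) := le_trans (by positivity) hq
  have h4 : -(L / 4) * ‖e - A‖ ^ 2 ≤ inner ℝ Δ e := by
    have h5 : 0 ≤ ‖Δ + (L / 2) • (e - A)‖ ^ 2 := by positivity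
    rw [norm_add_sq_real, norm_smul, inner_smul_right, inner_sub_right, mul_pow, Real.norm_eq_abs,
      sq_abs] at h5
    have : 0 ≤ L * (inner ℝ Δ e + L / 4 * ‖e - A‖ ^ 2) := by linarith
    have := nonneg_of_mul_nonneg_right this hL
    linarith
  have h6 : -(L / (4 * c)) * precondForm D β η (e - A, f - B) ≤ -(L / 4) * ‖e - A‖ ^ 2 := by
    have : L / (4 * c) * (c * ‖e - A‖ ^ 2) = L / 4 * ‖e - A‖ ^ 2 := by field_simp
    have := mul_le_mul_of_nonneg_left hq (show 0 ≤ L / (4 * c) by positivity)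
    linarith
  set q := precondForm D β η (e - A, f - B) with hqdef
  -- With `x = (A, B)` and `u = (e, f)`, this is `⟨W (x - u), u⟩`. The weighted sum of `h1` and `h2`
  -- bounds it below by `⟨Δ, e⟩`.
  set b := inner ℝ (A - e) e / β - inner ℝ (D e) (B - f) - inner ℝ (D (A - e)) f +
    inner ℝ (B - f) f / η with hb
  have hbΔ : inner ℝ Δ e ≤ b := by
    have h1' := div_nonneg h1 hβ.le
    have h2' := div_nonneg h2 hη.le
    have : b - inner ℝ Δ e = inner ℝ (A - β • G - β • Δ - e) e / β +
        inner ℝ (B + η • D ((2 : ℝ) • e - A) - f) f / η := by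
      simp only [hb, map_sub, map_smul, inner_sub_left, inner_sub_right, inner_add_left,
        real_inner_smul_left, hG]
      field_simp
      ring
    linarith
  have hexp : precondForm D β η (A + lam • (e - A), B + lam • (f - B)) =
      precondForm D β η (A, B) - 2 * lam * (q + b) + lam ^ 2 * q := by
    simp only [hqdef, hb, precondForm, ← real_inner_self_eq_norm_sq, map_add, map_sub, map_smul,
      inner_sub_left, inner_sub_right, inner_add_left, inner_add_right, real_inner_smul_left,
      real_inner_smul_right, real_inner_comm e A, real_inner_comm f B]
    ring
  have h7 : ε * q ≤ lam * (2 - L / (2 * c) - lam) * q := by gcongr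
  have h8 : -(L / (4 * c)) * q ≤ b := by linarith
  have h9 := mul_le_mul_of_nonneg_left h8 (show 0 ≤ 2 * lam by positivity)
  have h10 : L / (2 * c) = 2 * (L / (4 * c)) := by field_simp; ring
  rw [h10] at h7
  rw [hexp]
  linarith

/-- Convergence of the relaxed primal-dual iteration. -/
theorem primalDual_tendsto [FiniteDimensional ℝ X] [FiniteDimensional ℝ Y] (D : X →L[ℝ] Y)
    (Dt : Y →L[ℝ] X) (hDt : ∀ x y, inner ℝ (Dt y) x = inner ℝ (D x) y) {β η L ξ a : ℝ}
    (hβ : 0 < β) (hη : 0 < η) (hL : 0 < L) (hξ : 0 < ξ) (ha : 0 < a)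
    (hcond : L < 2 * ξ * (1 / β - η * ‖D‖ ^ 2))
    (F : X → X) (hF : Continuous F)
    (hcoc : ∀ x x', ‖F x - F x'‖ ^ 2 ≤ L * inner ℝ (F x - F x') (x - x'))
    (g : X → ℝ) (P : X → X) (hPc : Continuous P)
    (hP : ∀ x u, inner ℝ (x - P x) (u - P x) ≤ β * (g u - g (P x)))
    (C : Set Y) (ψ : Y → ℝ) (S : Y → Y) (hSc : Continuous S) (hSC : ∀ y, S y ∈ C)
    (hS : ∀ y, ∀ u ∈ C, inner ℝ (y - S y) (u - S y) ≤ η * (ψ u - ψ (S y)))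
    (T : X × Y → X × Y)
    (hT₁ : ∀ z, (T z).1 = P (z.1 - β • Dt z.2 - β • F z.1))
    (hT₂ : ∀ z, (T z).2 = S (z.2 + η • D ((2 : ℝ) • (T z).1 - z.1)))
    (p₀ : X × Y) (hp₀ : T p₀ = p₀)
    (lam : ℕ → ℝ) (hlam : ∀ k, a ≤ lam k) (hlam' : ∀ k, lam k ≤ 2 - ξ)
    (z : ℕ → X × Y) (hz : ∀ k, z (k + 1) = z k + lam k • (T (z k) - z k)) :
    ∃ p, T p = p ∧ Tendsto z atTop (𝓝 p) := by
  set c := 1 / β - η * ‖D‖ ^ 2 with hc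
  have hc0 : 0 < c := by
    by_contra! h
    nlinarith
  obtain ⟨c', hc'0, hc'⟩ := exists_mul_norm_sq_le_precondForm D hβ hη (by linarith)
  have hgap : 0 < ξ - L / (2 * c) := by
    rw [sub_pos, div_lt_iff₀ (by positivity)]
    linarith
  have hTc : Continuous T := by
    have h1 : Continuous fun z => (T z).1 := by
      simp only [hT₁]
      exact hPc.comp (by fun_prop)
    have h2 : Continuous fun z => (T z).2 := by
      simp only [hT₂]
      exact hSc.comp (by fun_prop)
    exact h1.prodMk h2
  have : ProperSpace X := FiniteDimensional.proper ℝ X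
  have : ProperSpace Y := FiniteDimensional.proper ℝ Y
  -- The constant `ε` combines `lam k ≥ a` with `2 - lam k ≥ ξ`.
  refine exists_fixedPoint_tendsto (precondForm D β η) ?_ ?_ c' hc'0 hc' T hTc
    (a * (ξ - L / (2 * c))) (by positivity) z ?_ p₀ hp₀
  · unfold precondForm
    fun_prop
  · simp [precondForm]
  · intro p hp k
    have hp1 := hT₁ p
    have hp2 := hT₂ p
    rw [hp] at hp1 hp2
    have hP1 := hP (p.1 - β • Dt p.2 - β • F p.1)
    have hS1 := hS (p.2 + η • D ((2 : ℝ) • p.1 - p.1))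
    rw [← hp1] at hP1
    rw [← hp2] at hS1
    have hf1 := inner_nonneg_of_variational
      (hP ((z k).1 - β • Dt (z k).2 - β • F (z k).1) p.1)
      (hP1 _)
    have hf2 := inner_nonneg_of_variational
      (hS ((z k).2 + η • D ((2 : ℝ) • (T (z k)).1 - (z k).1)) p.2 (by rw [hp2]; exact hSC _))
      (hS1 _ (hSC _))
    rw [← hT₁] at hf1
    rw [← hT₂] at hf2
    have key := precondForm_step_le D hβ hη hL hc hc0 (ha.trans_le (hlam k))
      (ε := a * (ξ - L / (2 * c))) (by
        refine mul_le_mul (hlam k) ?_ hgap.le (ha.le.trans (hlam k))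
        linarith [hlam' k])
      ((z k).1 - p.1) ((T (z k)).1 - p.1) (F (z k).1 - F p.1) (Dt ((z k).2 - p.2))
      ((z k).2 - p.2) ((T (z k)).2 - p.2) (fun x => hDt _ _)
      (by
        convert hf1 using 2
        rw [map_sub, smul_sub, smul_sub]
        abel)
      (by
        convert hf2 using 2
        simp only [map_sub, map_smul, smul_sub]
        module)
      (hcoc _ _)
    convert key using 2
    · congr 1
      rw [hz k]
      ext <;> simp <;> abel
    · congr 2
      ext <;> simp
    · rfl

/-- Cocoercivity of a Lipschitz gradient, in the quadratic case: the identity `‖S* S‖ = ‖S‖²` turns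
the Lipschitz bound into `c ‖S‖² ≤ L`. -/
theorem norm_adjoint_comp_sq_le {X Y : Type*} [NormedAddCommGroup X] [InnerProductSpace ℝ X]
    [CompleteSpace X] [NormedAddCommGroup Y] [InnerProductSpace ℝ Y] [CompleteSpace Y]
    (S : X →L[ℝ] Y) {c L : ℝ} (hc : 0 ≤ c) (hL : 0 ≤ L)
    (h : ∀ x, ‖c • S.adjoint (S x)‖ ≤ L * ‖x‖) (x : X) :
    ‖c • S.adjoint (S x)‖ ^ 2 ≤ L * inner ℝ (c • S.adjoint (S x)) x := by
  have h1 : c * (‖S‖ * ‖S‖) ≤ L := by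
    rw [← ContinuousLinearMap.norm_adjoint_comp_self, ← abs_of_nonneg hc, ← Real.norm_eq_abs,
      ← norm_smul]
    exact ContinuousLinearMap.opNorm_le_bound _ hL h
  have h2 : ‖S.adjoint (S x)‖ ^ 2 ≤ ‖S‖ * ‖S‖ * ‖S x‖ ^ 2 := by
    have := S.adjoint.le_opNorm (S x)
    rw [LinearIsometryEquiv.norm_map] at this
    nlinarith [norm_nonneg (S.adjoint (S x))]
  rw [norm_smul, mul_pow, Real.norm_eq_abs, sq_abs, real_inner_smul_left,
    ContinuousLinearMap.adjoint_inner_left, real_inner_self_eq_norm_sq]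
  calc c ^ 2 * ‖S.adjoint (S x)‖ ^ 2 ≤ c ^ 2 * (‖S‖ * ‖S‖ * ‖S x‖ ^ 2) := by gcongr
    _ = c * (‖S‖ * ‖S‖) * (c * ‖S x‖ ^ 2) := by ring
    _ ≤ L * (c * ‖S x‖ ^ 2) := by gcongr

end PrimalDual

/-! ### Proximity operators -/

/-- A point satisfying the variational inequality of the proximity operator is its value. -/
theorem prox_eq_of_variational {E : Type*} [NormedAddCommGroup E] [InnerProductSpace ℝ E]
    {ψ : E → EReal} {x p : E} {a : ℝ} (hbot : ∀ u, ψ u ≠ ⊥) (ha : ψ p = a)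
    (h : ∀ u (b : ℝ), ψ u = b → inner ℝ (x - p) (u - p) ≤ b - a) : prox ψ x = p := by
  -- By this expansion and `h`, the objective at `u` exceeds that at `p` by at least `½‖u - p‖²`,
  -- which yields both minimality and uniqueness.
  have hsq : ∀ u, ‖u - x‖ ^ 2 = ‖u - p‖ ^ 2 - 2 * inner ℝ (x - p) (u - p) + ‖p - x‖ ^ 2 := by
    intro u
    rw [← sub_sub_sub_cancel_right u x p, norm_sub_sq_real, real_inner_comm, norm_sub_rev x p]
  have hmem : p ∈ proxSet ψ x := by
    intro u _
    simp only [mem_ofPred_eq]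
    by_cases htop : ψ u = ⊤
    · rw [htop, EReal.coe_add_top]
      exact le_top
    · lift ψ u to ℝ using ⟨htop, hbot u⟩ with b hb
      rw [ha]
      norm_cast
      rw [hsq u]
      nlinarith [h u b hb.symm, sq_nonneg ‖u - p‖]
  have hspec : prox ψ x ∈ proxSet ψ x := Classical.epsilon_spec ⟨p, hmem⟩
  set q := prox ψ x
  have hq : ((1 / 2 * ‖q - x‖ ^ 2 : ℝ) : EReal) + ψ q ≤ ((1 / 2 * ‖p - x‖ ^ 2 : ℝ) : EReal) + ψ p :=
    hspec (mem_univ p)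
  by_cases htop : ψ q = ⊤
  · rw [htop, EReal.coe_add_top, ha] at hq
    exact absurd (top_le_iff.1 hq) (by norm_cast)
  · obtain ⟨b, hb⟩ : ∃ b : ℝ, ψ q = b := ⟨_, (EReal.coe_toReal htop (hbot q)).symm⟩
    rw [hb, ha] at hq
    norm_cast at hq
    rw [hsq q] at hq
    have : ‖q - p‖ ^ 2 ≤ 0 := by linarith [h q b hb]
    have : ‖q - p‖ = 0 := by nlinarith [norm_nonneg (q - p)]
    exact sub_eq_zero.1 (norm_eq_zero.1 this)

theorem conj_iota_of_nonpos {n : Type*} [Fintype n] (d : n → ℝ) (y : EuclideanSpace ℝ n)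
    (hy : ∀ j, y j ≤ 0) :
    conj (iota d) y = ((inner ℝ y (WithLp.toLp 2 d : EuclideanSpace ℝ n) : ℝ) : EReal) := by
  refine le_antisymm (iSup_le fun u => ?_) (le_iSup_of_le (WithLp.toLp 2 d) ?_)
  · by_cases hu : ∀ j, d j ≤ u j
    · simp only [iota, hu, implies_true, if_true, sub_zero, EReal.coe_le_coe_iff]
      simp only [PiLp.inner_apply, RCLike.inner_apply, conj_trivial]
      exact Finset.sum_le_sum fun j _ => mul_le_mul_of_nonpos_right (hu j) (hy j)
    · simp [iota, hu]
  · simp [iota]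

theorem conj_iota_of_pos {n : Type*} [Fintype n] [DecidableEq n] (d : n → ℝ)
    (y : EuclideanSpace ℝ n) {j : n} (hy : 0 < y j) : conj (iota d) y = ⊤ := by
  rw [EReal.eq_top_iff_forall_lt]
  intro M
  set v : EuclideanSpace ℝ n := WithLp.toLp 2 d
  -- Moving from `d` by `s` along the `j`-th axis stays in the domain of `iota d` and raises the
  -- pairing with `y` to at least `M + 1`.
  set s := |M + 1 - inner ℝ y v| / y j with hs
  have hs0 : 0 ≤ s := by positivity
  have hle : ((inner ℝ y (v + s • EuclideanSpace.single j 1) : ℝ) : EReal) ≤ conj (iota d) y := by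
    refine le_iSup_of_le (v + s • EuclideanSpace.single j 1) ?_
    have : ∀ i, d i ≤ (v + s • EuclideanSpace.single j (1 : ℝ)) i := fun i => by
      by_cases hij : i = j <;> simp [v, hij, hs0]
    rw [iota, if_pos this, sub_zero]
  refine lt_of_lt_of_le ?_ hle
  rw [EReal.coe_lt_coe_iff, inner_add_right, inner_smul_right, EuclideanSpace.inner_single_right]
  have : s * y j = |M + 1 - inner ℝ y v| := div_mul_cancel₀ _ hy.ne'
  have := le_abs_self (M + 1 - inner ℝ y v)
  simp only [conj_trivial, one_mul]
  linarith

/-- The Euclidean projection of `y - η d` onto the nonpositive orthant. -/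
noncomputable def dualProx {n : Type*} (d : n → ℝ) (η : ℝ) (y : EuclideanSpace ℝ n) :
    EuclideanSpace ℝ n :=
  WithLp.toLp 2 fun j => min (y j - η * d j) 0

theorem dualProx_nonpos {n : Type*} (d : n → ℝ) (η : ℝ) (y : EuclideanSpace ℝ n) (j : n) :
    dualProx d η y j ≤ 0 := min_le_right _ _

theorem continuous_dualProx {n : Type*} [Fintype n] (d : n → ℝ) (η : ℝ) :
    Continuous (dualProx d η) := by
  unfold dualProx
  fun_prop

theorem inner_dualProx_le {n : Type*} [Fintype n] (d : n → ℝ) (η : ℝ)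
    (y u : EuclideanSpace ℝ n) (hu : ∀ j, u j ≤ 0) :
    inner ℝ (y - dualProx d η y) (u - dualProx d η y) ≤
      η * (inner ℝ u (WithLp.toLp 2 d : EuclideanSpace ℝ n) -
        inner ℝ (dualProx d η y) (WithLp.toLp 2 d : EuclideanSpace ℝ n)) := by
  rw [← inner_sub_left]
  simp only [PiLp.inner_apply, RCLike.inner_apply, conj_trivial, PiLp.sub_apply, Finset.mul_sum]
  refine Finset.sum_le_sum fun j _ => ?_
  simp only [dualProx]
  rcases le_total (y j - η * d j) 0 with h | h
  · rw [min_eq_left h]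
    apply le_of_eq
    ring
  · rw [min_eq_right h]
    nlinarith [hu j]

theorem prox_conj_iota {n : Type*} [Fintype n] [DecidableEq n] (d : n → ℝ) {η : ℝ} (hη : 0 < η)
    (y : EuclideanSpace ℝ n) :
    prox (fun y => (η : EReal) * conj (iota d) y) y = dualProx d η y := by
  have hval : ∀ u : EuclideanSpace ℝ n, (∀ j, u j ≤ 0) → (η : EReal) * conj (iota d) u =
      ((η * inner ℝ u (WithLp.toLp 2 d : EuclideanSpace ℝ n) : ℝ) : EReal) := fun u hu => by
    rw [conj_iota_of_nonpos d u hu, EReal.coe_mul]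
  have htop : ∀ u : EuclideanSpace ℝ n, (¬ ∀ j, u j ≤ 0) → (η : EReal) * conj (iota d) u = ⊤ := by
    intro u hu
    push Not at hu
    obtain ⟨j, hj⟩ := hu
    rw [conj_iota_of_pos d u hj, EReal.coe_mul_top_of_pos hη]
  refine prox_eq_of_variational (fun u => ?_) (hval _ (dualProx_nonpos d η y)) fun u b hb => ?_
  · by_cases hu : ∀ j, u j ≤ 0
    · rw [hval u hu]
      exact EReal.coe_ne_bot _
    · rw [htop u hu]
      exact top_ne_bot
  · by_cases hu : ∀ j, u j ≤ 0
    · rw [hval u hu, EReal.coe_eq_coe_iff] at hb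
      rw [← hb, ← mul_sub]
      exact inner_dualProx_le d η y u hu
    · rw [htop u hu] at hb
      exact absurd hb.symm (EReal.coe_ne_top b)

theorem gFun_apply (N : ℕ) (τ : ℝ) (v : EuclideanSpace ℝ (Var N)) :
    gFun N τ v = τ * ∑ i, |v (Sum.inl i)| := by
  simp [gFun, app, matI, Matrix.fromCols_mulVec]

/-- Soft thresholding of the first `N` components. -/
noncomputable def softThreshold (N : ℕ) (c : ℝ) (x : EuclideanSpace ℝ (Var N)) :
    EuclideanSpace ℝ (Var N) :=
  x - WithLp.toLp 2 (Sum.elim (fun i => max (-c) (min c (x (Sum.inl i)))) fun _ => 0)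

theorem continuous_softThreshold (N : ℕ) (c : ℝ) : Continuous (softThreshold N c) := by
  unfold softThreshold
  refine continuous_id.sub ((PiLp.continuous_toLp 2 _).comp (continuous_pi fun i => ?_))
  rcases i with i | i <;> simp only [Sum.elim_inl, Sum.elim_inr] <;> fun_prop

/-- The inequality separates over coordinates. The difference `x - softThreshold` clips each
thresholded coordinate to `[-c, c]`, and the three cases of the clipping are checked in turn. -/
theorem inner_softThreshold_le (N : ℕ) {τ β : ℝ} (hτ : 0 ≤ τ) (hβ : 0 < β)
    (x u : EuclideanSpace ℝ (Var N)) :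
    inner ℝ (x - softThreshold N (β * τ) x) (u - softThreshold N (β * τ) x) ≤
      β * (gFun N τ u - gFun N τ (softThreshold N (β * τ) x)) := by
  rw [gFun_apply, gFun_apply, ← mul_sub, ← Finset.sum_sub_distrib, ← mul_assoc, Finset.mul_sum]
  have hc : 0 ≤ β * τ := by positivity
  generalize β * τ = c at hc
  simp only [PiLp.inner_apply, RCLike.inner_apply, conj_trivial, PiLp.sub_apply,
    Fintype.sum_sum_type, softThreshold, Sum.elim_inl, Sum.elim_inr]
  simp only [sub_zero, sub_self, mul_zero, Finset.sum_const_zero, add_zero, sub_sub_cancel]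
  refine Finset.sum_le_sum fun i _ => ?_
  generalize x (Sum.inl i) = a
  generalize u (Sum.inl i) = b
  have hbl := le_abs_self b
  have hbl' := neg_abs_le b
  rcases le_total c a with h | h
  · rw [min_eq_left h, max_eq_right (by linarith), abs_of_nonneg (by linarith : 0 ≤ a - c)]
    nlinarith
  · rw [min_eq_right h]
    rcases le_total (-c) a with h' | h'
    · rw [max_eq_right h', sub_self, abs_zero, sub_zero, sub_zero]
      calc b * a ≤ |b * a| := le_abs_self _
        _ = |a| * |b| := by rw [abs_mul, mul_comm]
        _ ≤ c * |b| := by gcongr; exact abs_le.2 ⟨h', h⟩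
    · rw [max_eq_left h', abs_of_nonpos (by linarith : a - -c ≤ 0)]
      nlinarith

theorem prox_gFun (N : ℕ) {τ β : ℝ} (hτ : 0 ≤ τ) (hβ : 0 < β) (x : EuclideanSpace ℝ (Var N)) :
    prox (fun v => ((β * gFun N τ v : ℝ) : EReal)) x = softThreshold N (β * τ) x := by
  refine prox_eq_of_variational (fun u => EReal.coe_ne_bot _) rfl fun u b hb => ?_
  rw [← EReal.coe_eq_coe_iff.1 hb, ← mul_sub]
  exact inner_softThreshold_le N hτ hβ x u

/-! ### Block vectors and matrices -/

/-- A matrix as a continuous linear map between Euclidean spaces. -/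
noncomputable def appL {m n : Type*} [Fintype m] [Fintype n] [DecidableEq n] (M : Matrix m n ℝ) :
    EuclideanSpace ℝ n →L[ℝ] EuclideanSpace ℝ m :=
  LinearMap.toContinuousLinearMap (Matrix.toEuclideanLin M)

@[simp] theorem appL_apply {m n : Type*} [Fintype m] [Fintype n] [DecidableEq n]
    (M : Matrix m n ℝ) (x : EuclideanSpace ℝ n) : appL M x = app M x := rfl

theorem inner_app_transpose {m n : Type*} [Fintype m] [Fintype n] (M : Matrix m n ℝ)
    (x : EuclideanSpace ℝ n) (y : EuclideanSpace ℝ m) :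
    inner ℝ (app Mᵀ y) x = inner ℝ (app M x) y := by
  simp only [app, EuclideanSpace.inner_eq_star_dotProduct, star_trivial]
  rw [Matrix.mulVec_transpose, dotProduct_comm, ← Matrix.dotProduct_mulVec]

section Blocks

variable {m n : Type*}

@[simp] theorem fstBlock_stack (v : EuclideanSpace ℝ m) (y : EuclideanSpace ℝ n) :
    fstBlock (stack v y) = v := rfl

@[simp] theorem sndBlock_stack (v : EuclideanSpace ℝ m) (y : EuclideanSpace ℝ n) :
    sndBlock (stack v y) = y := rfl

@[simp] theorem stack_blocks (z : EuclideanSpace ℝ (m ⊕ n)) :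
    stack (fstBlock z) (sndBlock z) = z := by
  ext i
  rcases i with i | i <;> rfl

theorem fstBlock_add (z w : EuclideanSpace ℝ (m ⊕ n)) :
    fstBlock (z + w) = fstBlock z + fstBlock w := rfl

theorem sndBlock_add (z w : EuclideanSpace ℝ (m ⊕ n)) :
    sndBlock (z + w) = sndBlock z + sndBlock w := rfl

theorem fstBlock_sub (z w : EuclideanSpace ℝ (m ⊕ n)) :
    fstBlock (z - w) = fstBlock z - fstBlock w := rfl

theorem sndBlock_sub (z w : EuclideanSpace ℝ (m ⊕ n)) :
    sndBlock (z - w) = sndBlock z - sndBlock w := rfl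

theorem inner_eq_blocks [Fintype m] [Fintype n] (z w : EuclideanSpace ℝ (m ⊕ n)) :
    inner ℝ z w = inner ℝ (fstBlock z) (fstBlock w) + inner ℝ (sndBlock z) (sndBlock w) := by
  simp [PiLp.inner_apply, fstBlock, sndBlock]

theorem app_fromBlocks [Fintype m] [Fintype n] (A : Matrix m m ℝ) (B : Matrix m n ℝ)
    (C : Matrix n m ℝ) (D : Matrix n n ℝ) (z : EuclideanSpace ℝ (m ⊕ n)) :
    app (Matrix.fromBlocks A B C D) z =
      stack (app A (fstBlock z) + app B (sndBlock z)) (app C (fstBlock z) + app D (sndBlock z)) := by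
  ext i
  simp only [app, Matrix.fromBlocks_mulVec, stack, fstBlock, sndBlock]
  rcases i with i | i <;> rfl

theorem app_smul_left [Fintype m] (c : ℝ) (M : Matrix n m ℝ) (x : EuclideanSpace ℝ m) :
    app (c • M) x = c • app M x := by
  simp [app, Matrix.smul_mulVec]

theorem app_neg_left [Fintype m] (M : Matrix n m ℝ) (x : EuclideanSpace ℝ m) :
    app (-M) x = -app M x := by
  simp [app, Matrix.neg_mulVec]

@[simp] theorem app_one [Fintype m] [DecidableEq m] (x : EuclideanSpace ℝ m) :
    app (1 : Matrix m m ℝ) x = x := by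
  simp [app]

theorem app_add [Fintype m] (M : Matrix n m ℝ) (x y : EuclideanSpace ℝ m) :
    app M (x + y) = app M x + app M y := by
  simp [app, Matrix.mulVec_add]

theorem app_sub [Fintype m] (M : Matrix n m ℝ) (x y : EuclideanSpace ℝ m) :
    app M (x - y) = app M x - app M y := by
  simp [app, Matrix.mulVec_sub]

theorem app_smul [Fintype m] (M : Matrix n m ℝ) (c : ℝ) (x : EuclideanSpace ℝ m) :
    app M (c • x) = c • app M x := by
  simp [app, Matrix.mulVec_smul]

theorem app_sub_left [Fintype m] (M M' : Matrix n m ℝ) (x : EuclideanSpace ℝ m) :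
    app (M - M') x = app M x - app M' x := by
  simp [app, Matrix.sub_mulVec]

/-- The blocks of a vector, as a continuous linear equivalence. -/
noncomputable def blocks [Fintype m] [Fintype n] :
    EuclideanSpace ℝ (m ⊕ n) ≃L[ℝ] EuclideanSpace ℝ m × EuclideanSpace ℝ n :=
  LinearEquiv.toContinuousLinearEquiv
    { toFun := fun z => (fstBlock z, sndBlock z)
      invFun := fun p => stack p.1 p.2
      map_add' := fun _ _ => rfl
      map_smul' := fun _ _ => rfl
      left_inv := fun z => stack_blocks z
      right_inv := fun _ => rfl }

@[simp] theorem blocks_apply [Fintype m] [Fintype n] (z : EuclideanSpace ℝ (m ⊕ n)) :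
    blocks z = (fstBlock z, sndBlock z) := rfl

end Blocks

theorem gradient_rFun {m n : Type*} [Fintype m] [Fintype n]
    {f : EuclideanSpace ℝ m → ℝ} {z : EuclideanSpace ℝ (m ⊕ n)}
    {f' : EuclideanSpace ℝ m} (hf : HasGradientAt f f' (fstBlock z)) :
    gradient (rFun n f) z = stack f' 0 := by
  refine HasGradientAt.gradient ?_
  rw [hasGradientAt_iff_hasFDerivAt] at hf ⊢
  have hfst : HasFDerivAt (fstBlock : EuclideanSpace ℝ (m ⊕ n) → EuclideanSpace ℝ m)
      ((ContinuousLinearMap.fst ℝ _ _).comp (blocks : EuclideanSpace ℝ (m ⊕ n) ≃L[ℝ]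
        EuclideanSpace ℝ m × EuclideanSpace ℝ n).toContinuousLinearMap) z :=
    ((ContinuousLinearMap.fst ℝ _ _).comp (blocks : EuclideanSpace ℝ (m ⊕ n) ≃L[ℝ]
      EuclideanSpace ℝ m × EuclideanSpace ℝ n).toContinuousLinearMap).hasFDerivAt
  refine (hf.comp z hfst).congr_fderiv ?_
  ext w
  simp [inner_eq_blocks, sndBlock_stack]

/-! ### Explicit form of the operators `T_G` and `T_W` -/

section Operators

variable {m n : Type*} [Fintype m] [Fintype n] [DecidableEq m] [DecidableEq n]

theorem app_matW (D : Matrix n m ℝ) (β η : ℝ) (z : EuclideanSpace ℝ (m ⊕ n)) :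
    app (matW D β η) z = stack ((1 / β) • fstBlock z - app Dᵀ (sndBlock z))
      ((1 / η) • sndBlock z - app D (fstBlock z)) := by
  rw [matW, app_fromBlocks, app_smul_left, app_smul_left, app_neg_left, app_neg_left, app_one,
    app_one, sub_eq_add_neg, sub_eq_neg_add]

theorem app_matG (D : Matrix n m ℝ) (β η : ℝ) (z : EuclideanSpace ℝ (m ⊕ n)) :
    app (matG D β η) z = stack (fstBlock z - β • app Dᵀ (sndBlock z))
      (sndBlock z - η • app D (fstBlock z)) := by
  rw [matG, app_fromBlocks, app_neg_left, app_neg_left, app_smul_left, app_smul_left, app_one,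
    app_one, sub_eq_add_neg, sub_eq_neg_add]

theorem app_matE (D : Matrix n m ℝ) (β η : ℝ) (z : EuclideanSpace ℝ (m ⊕ n)) :
    app (matE D β η) z = stack (fstBlock z - β • app Dᵀ (sndBlock z))
      (sndBlock z + η • app D (fstBlock z)) := by
  rw [matE, app_fromBlocks, app_neg_left, app_smul_left, app_smul_left, app_one,
    app_one, sub_eq_add_neg, add_comm (sndBlock z)]

/-- `G = P W` with `P` block diagonal. -/
theorem app_matG_eq_app_matW (D : Matrix n m ℝ) {β η : ℝ} (hβ : β ≠ 0) (hη : η ≠ 0)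
    (z : EuclideanSpace ℝ (m ⊕ n)) :
    app (matG D β η) z =
      stack (β • fstBlock (app (matW D β η) z)) (η • sndBlock (app (matW D β η) z)) := by
  rw [app_matG, app_matW]
  simp only [fstBlock_stack, sndBlock_stack, smul_sub, smul_smul]
  rw [mul_one_div_cancel hβ, mul_one_div_cancel hη, one_smul, one_smul]

theorem inner_app_matW (D : Matrix n m ℝ) (β η : ℝ) (z : EuclideanSpace ℝ (m ⊕ n)) :
    inner ℝ (app (matW D β η) z) z = precondForm (appL D) β η (fstBlock z, sndBlock z) := by
  rw [inner_eq_blocks, app_matW, fstBlock_stack, sndBlock_stack, inner_sub_left, inner_sub_left,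
    inner_app_transpose, real_inner_smul_left, real_inner_smul_left, real_inner_self_eq_norm_sq,
    real_inner_self_eq_norm_sq, precondForm, appL_apply]
  ring

/-- The quadratic form of `W` is positive definite under the step size condition, so `W` has trivial
kernel and its matrix inverse is genuine. -/
theorem app_matW_inv (D : Matrix n m ℝ) {β η : ℝ} (hβ : 0 < β) (hη : 0 < η)
    (h : η * specNorm D ^ 2 < 1 / β) (z : EuclideanSpace ℝ (m ⊕ n)) :
    app (matW D β η) (app (matW D β η)⁻¹ z) = z := by
  obtain ⟨c, hc, hcW⟩ := exists_mul_norm_sq_le_precondForm (appL D) hβ hη h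
  have hunit : IsUnit (matW D β η) := by
    rw [← Matrix.mulVec_injective_iff_isUnit]
    refine (injective_iff_map_eq_zero (matW D β η).mulVecLin).2 fun x hx => ?_
    have h0 : app (matW D β η) (WithLp.toLp 2 x) = 0 := by
      change WithLp.toLp 2 (matW D β η *ᵥ x) = 0
      rw [← Matrix.mulVecLin_apply, hx]
      rfl
    have h1 := hcW (blocks (WithLp.toLp 2 x))
    rw [blocks_apply, ← inner_app_matW, h0, inner_zero_left, ← blocks_apply] at h1
    have h2 : ‖blocks (WithLp.toLp 2 x : EuclideanSpace ℝ (m ⊕ n))‖ = 0 := by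
      have := norm_nonneg (blocks (WithLp.toLp 2 x : EuclideanSpace ℝ (m ⊕ n)))
      by_contra hne
      have : 0 < c * ‖blocks (WithLp.toLp 2 x : EuclideanSpace ℝ (m ⊕ n))‖ ^ 2 := by positivity
      linarith
    rw [norm_eq_zero, map_eq_zero_iff _ blocks.injective] at h2
    simpa using h2
  rw [Matrix.isUnit_iff_isUnit_det] at hunit
  simp [app, Matrix.mulVec_mulVec, Matrix.mul_nonsing_inv _ hunit]

/-- The implicit equation defining `T_G` has a solution, which is given explicitly blockwise. -/
theorem opTG_blocks (g : EuclideanSpace ℝ m → ℝ) (D : Matrix n m ℝ) (d : n → ℝ) (β η : ℝ)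
    (z : EuclideanSpace ℝ (m ⊕ n)) :
    fstBlock (opTG g D d β η z) =
        prox (fun v => ((β * g v : ℝ) : EReal)) (fstBlock (app (matG D β η) z)) ∧
      sndBlock (opTG g D d β η z) = prox (fun y => (η : EReal) * conj (iota d) y)
        ((2 * η) • app D (fstBlock (opTG g D d β η z)) + sndBlock (app (matG D β η) z)) := by
  -- The first block does not involve `u` and the second involves only its first block, so the
  -- implicit equation is solved by substitution.
  have harg : ∀ u, app (matE D β η - matG D β η) u + app (matG D β η) z =
      stack (fstBlock (app (matG D β η) z))
        ((2 * η) • app D (fstBlock u) + sndBlock (app (matG D β η) z)) := by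
    intro u
    rw [app_sub_left, app_matE, app_matG]
    apply blocks.injective
    ext1
    · simp [fstBlock_add, fstBlock_sub]
    · simp only [blocks_apply, sndBlock_add, sndBlock_sub, sndBlock_stack]
      module
  have hspec : opTG g D d β η z = opF g d β η (app (matE D β η - matG D β η) (opTG g D d β η z) +
      app (matG D β η) z) := by
    refine Classical.epsilon_spec (p := fun u =>
      u = opF g d β η (app (matE D β η - matG D β η) u + app (matG D β η) z)) ?_
    refine ⟨stack (prox (fun v => ((β * g v : ℝ) : EReal)) (fstBlock (app (matG D β η) z)))
      (prox (fun y => (η : EReal) * conj (iota d) y) ((2 * η) • app D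
        (prox (fun v => ((β * g v : ℝ) : EReal)) (fstBlock (app (matG D β η) z))) +
          sndBlock (app (matG D β η) z))), ?_⟩
    rw [harg, opF]
    simp only [fstBlock_stack, sndBlock_stack]
  rw [harg, opF, fstBlock_stack, sndBlock_stack] at hspec
  have h1 := congrArg fstBlock hspec
  have h2 := congrArg sndBlock hspec
  rw [fstBlock_stack] at h1
  rw [sndBlock_stack] at h2
  exact ⟨h1, h2⟩

theorem opTW_blocks {f g : EuclideanSpace ℝ m → ℝ} (D : Matrix n m ℝ) (d : n → ℝ) {β η : ℝ}
    (hβ : 0 < β) (hη : 0 < η) (h : η * specNorm D ^ 2 < 1 / β)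
    (z : EuclideanSpace ℝ (m ⊕ n)) {f' : EuclideanSpace ℝ m}
    (hf : HasGradientAt f f' (fstBlock z)) :
    fstBlock (opTW f g D d β η z) = prox (fun v => ((β * g v : ℝ) : EReal))
        (fstBlock z - β • app Dᵀ (sndBlock z) - β • f') ∧
      sndBlock (opTW f g D d β η z) = prox (fun y => (η : EReal) * conj (iota d) y)
        (sndBlock z + η • app D ((2 : ℝ) • fstBlock (opTW f g D d β η z) - fstBlock z)) := by
  have harg : app (matG D β η) (z - app (matW D β η)⁻¹ (gradient (rFun n f) z)) =
      stack (fstBlock z - β • app Dᵀ (sndBlock z) - β • f')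
        (sndBlock z - η • app D (fstBlock z)) := by
    rw [app_sub, app_matG_eq_app_matW D hβ.ne' hη.ne' (app _ _), app_matW_inv D hβ hη h,
      gradient_rFun hf, app_matG]
    apply blocks.injective
    ext1
    · simp [fstBlock_sub]
    · simp [sndBlock_sub]
  have key := opTG_blocks g D d β η (z - app (matW D β η)⁻¹ (gradient (rFun n f) z))
  rw [harg, fstBlock_stack, sndBlock_stack] at key
  refine ⟨key.1, key.2.trans ?_⟩
  congr 1
  rw [app_sub, app_smul]
  change (2 * η) • app D (fstBlock (opTW f g D d β η z)) + _ = _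
  module

end Operators

/-! ### The objective function and existence of a solution -/

theorem hasGradientAt_fFun {T N : ℕ} (R : Matrix (Fin T) (Fin N) ℝ)
    (v : EuclideanSpace ℝ (Var N)) :
    HasGradientAt (fFun R) ((2 / (T : ℝ)) • (appL (matR R)).adjoint (appL (matR R) v)) v := by
  rw [hasGradientAt_iff_hasFDerivAt]
  have h1 := ((appL (matR R)).hasFDerivAt (x := v)).norm_sq.const_mul (1 / (T : ℝ))
  refine h1.congr_fderiv ?_
  ext w
  simp [ContinuousLinearMap.adjoint_inner_left]
  ring

section Portfolio

variable {T N : ℕ} (R : Matrix (Fin T) (Fin N) ℝ)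

/-- The gradient of `fFun R`. -/
noncomputable def fGrad : EuclideanSpace ℝ (Var N) →L[ℝ] EuclideanSpace ℝ (Var N) :=
  (2 / (T : ℝ)) • (appL (matR R)).adjoint.comp (appL (matR R))

theorem hasGradientAt_fGrad (v : EuclideanSpace ℝ (Var N)) :
    HasGradientAt (fFun R) (fGrad R v) v := hasGradientAt_fFun R v

theorem fFun_nonneg (v : EuclideanSpace ℝ (Var N)) : 0 ≤ fFun R v := by
  unfold fFun
  positivity

theorem fFun_smul (t : ℝ) (v : EuclideanSpace ℝ (Var N)) :
    fFun R (t • v) = t ^ 2 * fFun R v := by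
  simp only [fFun, app_smul, norm_smul, mul_pow, Real.norm_eq_abs, sq_abs]
  ring

theorem fFun_add (v u : EuclideanSpace ℝ (Var N)) :
    fFun R (v + u) = fFun R v + inner ℝ (fGrad R v) u + fFun R u := by
  have : inner ℝ (fGrad R v) u = 2 / (T : ℝ) * inner ℝ (app (matR R) v) (app (matR R) u) := by
    simp [fGrad, real_inner_smul_left, ContinuousLinearMap.adjoint_inner_left]
  rw [this]
  simp only [fFun, app_add, norm_add_sq_real]
  ring

theorem continuous_fFun : Continuous (fFun R) :=
  continuous_iff_continuousAt.2 fun v =>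
    (hasGradientAt_fGrad R v).differentiableAt.continuousAt

theorem gFun_nonneg {τ : ℝ} (hτ : 0 ≤ τ) (v : EuclideanSpace ℝ (Var N)) : 0 ≤ gFun N τ v := by
  unfold gFun
  positivity

theorem gFun_smul (τ t : ℝ) (v : EuclideanSpace ℝ (Var N)) :
    gFun N τ (t • v) = |t| * gFun N τ v := by
  simp only [gFun_apply, PiLp.smul_apply, smul_eq_mul, abs_mul, ← Finset.mul_sum]
  ring

theorem continuous_gFun (τ : ℝ) : Continuous (gFun N τ) := by
  have : gFun N τ = fun v => τ * ∑ i, |v (Sum.inl i)| := funext (gFun_apply N τ)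
  rw [this]
  fun_prop

/-- Homogeneity (degree 2 for `f`, degree 1 for `g`) forces `f` and `g` to vanish at an asymptotic
direction `u` of a sublevel set. Then `R̃ u = 0`, and either `τ = 0` or `Ĩ u = 0`, so the objective
is constant along `u`. -/
theorem exists_isSolution {n : Type*} [Fintype n] (hT : 0 < T) {τ : ℝ} (hτ : 0 ≤ τ)
    (D : Matrix n (Var N) ℝ) (d : n → ℝ) (hfeas : (feasibleSet D d).Nonempty) :
    ∃ v, IsSolution (fun u => fFun R u + gFun N τ u) D d v := by
  obtain ⟨x₀, hx₀⟩ := hfeas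
  obtain ⟨v, hv, hmin⟩ := exists_isMinOn_polyhedron
    (fun j => (EuclideanSpace.proj j : EuclideanSpace ℝ n →L[ℝ] ℝ).comp (appL D)) d
    (fun u => fFun R u + gFun N τ u) ((continuous_fFun R).add (continuous_gFun τ)) (by
      intro v u C hinf hu hC x t
      have hinv := hinf.inv_tendsto_atTop
      have hf0 : fFun R u = 0 := by
        refine le_antisymm ?_ (fFun_nonneg R u)
        have h1 := ((continuous_fFun R).tendsto u).comp hu
        have h2 : Tendsto (fun k => (‖v k‖⁻¹) ^ 2 * C) atTop (𝓝 (0 ^ 2 * C)) :=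
          (hinv.pow 2).mul_const C
        rw [zero_pow two_ne_zero, zero_mul] at h2
        refine le_of_tendsto_of_tendsto' h1 h2 fun k => ?_
        rw [Function.comp_apply, fFun_smul]
        exact mul_le_mul_of_nonneg_left (by linarith [hC k, gFun_nonneg hτ (v k)]) (sq_nonneg _)
      have hg0 : gFun N τ u = 0 := by
        refine le_antisymm ?_ (gFun_nonneg hτ u)
        have h1 := ((continuous_gFun τ).tendsto u).comp hu
        have h2 : Tendsto (fun k => ‖v k‖⁻¹ * C) atTop (𝓝 (0 * C)) := hinv.mul_const C
        rw [zero_mul] at h2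
        refine le_of_tendsto_of_tendsto' h1 h2 fun k => ?_
        rw [Function.comp_apply, gFun_smul, abs_of_nonneg (by positivity)]
        exact mul_le_mul_of_nonneg_left (by linarith [hC k, fFun_nonneg R (v k)]) (by positivity)
      have hT' : (T : ℝ) ≠ 0 := by positivity
      have happ : app (matR R) u = 0 := by
        simpa [fFun, hT'] using hf0
      have hg : gFun N τ (x + t • u) = gFun N τ x := by
        rw [gFun_apply, mul_eq_zero] at hg0
        rcases hg0 with h | h
        · simp [gFun_apply, h]
        · rw [Finset.sum_eq_zero_iff_of_nonneg fun i _ => abs_nonneg _] at h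
          have hi : ∀ i, u (Sum.inl i) = 0 := fun i => abs_eq_zero.1 (h i (Finset.mem_univ i))
          simp [gFun_apply, hi]
      simp only [hg]
      simp [fFun, app_add, app_smul, happ]) x₀ hx₀
  exact ⟨v, hv, fun x hx => hmin x hx⟩

/-! ### Lagrange multipliers and fixed points -/

/-- `y` is a Lagrange multiplier of the problem at `v`. -/
def IsMultiplier {n : Type*} [Fintype n] (τ : ℝ) (D : Matrix n (Var N) ℝ) (d : n → ℝ)
    (v : EuclideanSpace ℝ (Var N)) (y : EuclideanSpace ℝ n) : Prop :=
  (∀ j, y j ≤ 0) ∧ (∀ j, y j * (app D v j - d j) = 0) ∧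
    ∀ a, 0 ≤ inner ℝ (fGrad R v) (a - v) + inner ℝ (app D (a - v)) y + (gFun N τ a - gFun N τ v)

theorem eventually_add_mul_le {a b p q : ℝ} (h : a ≤ b) (h' : a = b → p ≤ q) :
    ∀ᶠ t in 𝓝[>] (0 : ℝ), a + t * p ≤ b + t * q := by
  rcases h.eq_or_lt with h0 | h0
  · filter_upwards [self_mem_nhdsWithin] with t (ht : 0 < t)
    rw [h0]
    gcongr
    exact h' h0
  · have h1 : Tendsto (fun t => a + t * p) (𝓝 0) (𝓝 (a + 0 * p)) :=
      Continuous.tendsto (by fun_prop) 0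
    have h2 : Tendsto (fun t => b + t * q) (𝓝 0) (𝓝 (b + 0 * q)) :=
      Continuous.tendsto (by fun_prop) 0
    exact nhdsWithin_le_nhds ((h1.eventually_lt h2 (by simpa using h0)).mono fun t ht => ht.le)

/-- The first-order necessary condition, with the `ℓ¹` term linearized by an epigraph variable. -/
theorem directional_nonneg {n : Type*} [Fintype n] {τ : ℝ} (hτ : 0 ≤ τ)
    (D : Matrix n (Var N) ℝ) (d : n → ℝ) {v : EuclideanSpace ℝ (Var N)}
    (hv : IsSolution (fun u => fFun R u + gFun N τ u) D d v) (u : EuclideanSpace ℝ (Var N))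
    (s : Fin N → ℝ) (hD : ∀ j, app D v j = d j → 0 ≤ app D u j)
    (hs : ∀ i, 0 ≤ v (Sum.inl i) → u (Sum.inl i) ≤ s i)
    (hs' : ∀ i, v (Sum.inl i) ≤ 0 → -u (Sum.inl i) ≤ s i) :
    0 ≤ inner ℝ (fGrad R v) u + τ * ∑ i, s i := by
  have h1 : ∀ᶠ t in 𝓝[>] (0 : ℝ), ∀ j, d j + t * 0 ≤ app D v j + t * app D u j :=
    eventually_all.2 fun j => eventually_add_mul_le (hv.1 j) fun h => hD j h.symm
  have h2 : ∀ᶠ t in 𝓝[>] (0 : ℝ), ∀ i,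
      v (Sum.inl i) + t * u (Sum.inl i) ≤ |v (Sum.inl i)| + t * s i :=
    eventually_all.2 fun i => eventually_add_mul_le (le_abs_self _) fun h =>
      hs i (h ▸ abs_nonneg _)
  have h3 : ∀ᶠ t in 𝓝[>] (0 : ℝ), ∀ i,
      -v (Sum.inl i) + t * -u (Sum.inl i) ≤ |v (Sum.inl i)| + t * s i :=
    eventually_all.2 fun i => eventually_add_mul_le (neg_le_abs _) fun h =>
      hs' i (neg_nonneg.1 (h ▸ abs_nonneg _))
  -- As `f` is quadratic, optimality of `v` against `v + t u`, divided by `t`, leaves exactly the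
  -- remainder `t f(u)`.
  have hlim : Tendsto (fun t : ℝ => inner ℝ (fGrad R v) u + τ * ∑ i, s i + t * fFun R u) (𝓝[>] 0)
      (𝓝 (inner ℝ (fGrad R v) u + τ * ∑ i, s i + 0 * fFun R u)) := by
    refine Tendsto.mono_left (Continuous.tendsto ?_ 0) nhdsWithin_le_nhds
    fun_prop
  rw [zero_mul, add_zero] at hlim
  refine ge_of_tendsto hlim ?_
  filter_upwards [h1, h2, h3, self_mem_nhdsWithin] with t ht1 ht2 ht3 (ht : 0 < t)
  have hmin : fFun R v + gFun N τ v ≤ fFun R (v + t • u) + gFun N τ (v + t • u) :=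
    hv.2 (fun j => by simpa [app_add, app_smul] using ht1 j)
  have hg : gFun N τ (v + t • u) ≤ gFun N τ v + t * (τ * ∑ i, s i) := by
    have : ∑ i, |(v + t • u) (Sum.inl i)| ≤ ∑ i, (|v (Sum.inl i)| + t * s i) :=
      Finset.sum_le_sum fun i _ => abs_le'.2 ⟨ht2 i, by
        have := ht3 i
        simp only [PiLp.add_apply, PiLp.smul_apply, smul_eq_mul]
        linarith⟩
    rw [Finset.sum_add_distrib, ← Finset.mul_sum] at this
    rw [gFun_apply, gFun_apply]
    have := mul_le_mul_of_nonneg_left this hτ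
    linarith
  rw [fFun_add, fFun_smul, inner_smul_right] at hmin
  have : 0 ≤ t * (inner ℝ (fGrad R v) u + τ * ∑ i, s i + t * fFun R u) := by linarith
  exact nonneg_of_mul_nonneg_right this ht

/-- Farkas' lemma is applied in the variables `(u, s)`, where `s` bounds the variation of the
absolute values. The vectors `A` are the gradients of the active constraints among `D v ≥ d`, `s - v
≥ 0` and `s + v ≥ 0`. -/
theorem exists_isMultiplier {n : Type*} [Fintype n] [DecidableEq n] {τ : ℝ} (hτ : 0 ≤ τ)
    (D : Matrix n (Var N) ℝ) (d : n → ℝ) {v : EuclideanSpace ℝ (Var N)}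
    (hv : IsSolution (fun u => fFun R u + gFun N τ u) D d v) :
    ∃ y, IsMultiplier R τ D d v y := by
  classical
  set A : n ⊕ (Fin N ⊕ Fin N) → EuclideanSpace ℝ (Var N ⊕ Fin N) :=
    Sum.elim
      (fun j => if app D v j = d j then stack (app Dᵀ (EuclideanSpace.single j 1)) 0 else 0)
      (Sum.elim
        (fun i => if 0 ≤ v (Sum.inl i) then
          stack (-EuclideanSpace.single (Sum.inl i) 1) (EuclideanSpace.single i 1) else 0)
        (fun i => if v (Sum.inl i) ≤ 0 then
          stack (EuclideanSpace.single (Sum.inl i) 1) (EuclideanSpace.single i 1) else 0)) with hA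
  have hA1 : ∀ j z, inner ℝ (A (Sum.inl j)) z =
      if app D v j = d j then app D (fstBlock z) j else 0 := by
    intro j z
    simp only [hA, Sum.elim_inl]
    split_ifs
    · simp [inner_eq_blocks, inner_app_transpose, EuclideanSpace.inner_single_right]
    · simp
  have hA2 : ∀ i z, inner ℝ (A (Sum.inr (Sum.inl i))) z =
      if 0 ≤ v (Sum.inl i) then sndBlock z i - fstBlock z (Sum.inl i) else 0 := by
    intro i z
    simp only [hA, Sum.elim_inl, Sum.elim_inr]
    split_ifs
    · simp [inner_eq_blocks, EuclideanSpace.inner_single_left]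
      ring
    · simp
  have hA3 : ∀ i z, inner ℝ (A (Sum.inr (Sum.inr i))) z =
      if v (Sum.inl i) ≤ 0 then sndBlock z i + fstBlock z (Sum.inl i) else 0 := by
    intro i z
    simp only [hA, Sum.elim_inr]
    split_ifs
    · simp [inner_eq_blocks, EuclideanSpace.inner_single_left]
      ring
    · simp
  set c : EuclideanSpace ℝ (Var N ⊕ Fin N) := stack (fGrad R v) (WithLp.toLp 2 fun _ => τ) with hc
  have hcz : ∀ z, inner ℝ c z =
      inner ℝ (fGrad R v) (fstBlock z) + τ * ∑ i, sndBlock z i := by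
    intro z
    rw [hc, inner_eq_blocks, fstBlock_stack, sndBlock_stack]
    simp [PiLp.inner_apply, Finset.mul_sum, mul_comm]
  obtain ⟨w, hw0, hw⟩ := exists_nonneg_sum_smul_eq A c (by
    intro z hz
    rw [hcz]
    refine directional_nonneg R hτ D d hv _ _ (fun j hj => ?_) (fun i hi => ?_) (fun i hi => ?_)
    · simpa [hA1, hj] using hz (Sum.inl j)
    · simpa [hA2, hi] using hz (Sum.inr (Sum.inl i))
    · have := hz (Sum.inr (Sum.inr i))
      rw [hA3, if_pos hi] at this
      linarith)
  -- The sign is reversed because the dual variable lives in the nonpositive orthant; inactive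
  -- constraints get zero, which is complementarity.
  refine ⟨WithLp.toLp 2 fun j => if app D v j = d j then -w (Sum.inl j) else 0, fun j => ?_,
    fun j => ?_, fun a => ?_⟩
  · have := hw0 (Sum.inl j)
    dsimp only
    split_ifs <;> linarith
  · dsimp only
    split_ifs with h
    · rw [h, sub_self, mul_zero]
    · rw [zero_mul]
  -- Pairing the Farkas identity with `(a - v, |a| - |v|)` makes the contributions of the absolute
  -- value constraints nonnegative.
  · have key := congrArg
      (fun e => inner ℝ e (stack (a - v) (WithLp.toLp 2 fun i => |a (Sum.inl i)| - |v (Sum.inl i)|)))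
      hw
    simp only [inner_add_left, sum_inner, real_inner_smul_left, Fintype.sum_sum_type, hcz, hA1, hA2,
      hA3, fstBlock_stack, sndBlock_stack, Finset.sum_sub_distrib] at key
    rw [gFun_apply, gFun_apply, ← mul_sub]
    have hy : inner ℝ (app D (a - v))
        (WithLp.toLp 2 fun j => if app D v j = d j then -w (Sum.inl j) else 0 :
          EuclideanSpace ℝ n) =
        -∑ j, w (Sum.inl j) * (if app D v j = d j then app D (a - v) j else 0) := by
      rw [← Finset.sum_neg_distrib]
      simp only [PiLp.inner_apply, RCLike.inner_apply, conj_trivial]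
      refine Finset.sum_congr rfl fun j _ => ?_
      split_ifs <;> ring
    have hp : 0 ≤ ∑ i, w (Sum.inr (Sum.inl i)) * (if 0 ≤ v (Sum.inl i) then
        |a (Sum.inl i)| - |v (Sum.inl i)| - (a - v) (Sum.inl i) else 0) := by
      refine Finset.sum_nonneg fun i _ => mul_nonneg (hw0 _) ?_
      split_ifs with h
      · rw [abs_of_nonneg h, PiLp.sub_apply]
        linarith [le_abs_self (a (Sum.inl i))]
      · exact le_rfl
    have hm : 0 ≤ ∑ i, w (Sum.inr (Sum.inr i)) * (if v (Sum.inl i) ≤ 0 then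
        |a (Sum.inl i)| - |v (Sum.inl i)| + (a - v) (Sum.inl i) else 0) := by
      refine Finset.sum_nonneg fun i _ => mul_nonneg (hw0 _) ?_
      split_ifs with h
      · rw [abs_of_nonpos h, PiLp.sub_apply]
        linarith [neg_le_abs (a (Sum.inl i))]
      · exact le_rfl
    rw [hy]
    linarith

theorem isSolution_of_isMultiplier {n : Type*} [Fintype n] {τ : ℝ}
    (D : Matrix n (Var N) ℝ) (d : n → ℝ) {v : EuclideanSpace ℝ (Var N)}
    (hv : v ∈ feasibleSet D d) {y : EuclideanSpace ℝ n} (hy : IsMultiplier R τ D d v y) :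
    IsSolution (fun u => fFun R u + gFun N τ u) D d v := by
  refine ⟨hv, fun a ha => ?_⟩
  obtain ⟨h1, h2, h3⟩ := hy
  have hf := fFun_add R v (a - v)
  rw [add_sub_cancel] at hf
  -- By complementarity the pairing equals `∑ y_j ((D a)_j - d_j)`, a sum of nonpositive terms.
  have hneg : inner ℝ (app D (a - v)) y ≤ 0 := by
    simp only [PiLp.inner_apply, RCLike.inner_apply, conj_trivial]
    refine Finset.sum_nonpos fun j _ => ?_
    rw [app_sub, PiLp.sub_apply]
    nlinarith [h1 j, h2 j, ha j]
  simp only [mem_ofPred_eq]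
  linarith [h3 a, fFun_nonneg R (a - v)]

theorem norm_fGrad_sq_le {L : ℝ} (hL : 0 < L)
    (hLip : ∀ x y, ‖gradient (fFun R) x - gradient (fFun R) y‖ ≤ L * ‖x - y‖)
    (x y : EuclideanSpace ℝ (Var N)) :
    ‖fGrad R x - fGrad R y‖ ^ 2 ≤ L * inner ℝ (fGrad R x - fGrad R y) (x - y) := by
  rw [← map_sub]
  refine norm_adjoint_comp_sq_le (appL (matR R)) (by positivity) hL.le (fun u => ?_) (x - y)
  have := hLip u 0
  rw [(hasGradientAt_fGrad R u).gradient, (hasGradientAt_fGrad R 0).gradient, map_zero, sub_zero,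
    sub_zero] at this
  exact this

theorem dualProx_eq_self_iff {n : Type*} (d : n → ℝ) {η : ℝ} (hη : 0 < η)
    (y x : EuclideanSpace ℝ n) : dualProx d η (y + η • x) = y ↔
      (∀ j, y j ≤ 0) ∧ (∀ j, d j ≤ x j) ∧ ∀ j, y j * (x j - d j) = 0 := by
  have hj : ∀ j, dualProx d η (y + η • x) j = min (y j + η * (x j - d j)) 0 := fun j => by
    simp only [dualProx, PiLp.add_apply, PiLp.smul_apply, smul_eq_mul]
    congr 1
    ring
  constructor
  · intro h
    have hmin : ∀ j, min (y j + η * (x j - d j)) 0 = y j := fun j => by rw [← hj, h]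
    have h1 : ∀ j, y j ≤ 0 := fun j => hmin j ▸ min_le_right _ _
    have h2 : ∀ j, d j ≤ x j := fun j => by
      have : y j ≤ y j + η * (x j - d j) := (hmin j).symm.le.trans (min_le_left _ _)
      exact sub_nonneg.1 (nonneg_of_mul_nonneg_right (by linarith) hη)
    refine ⟨h1, h2, fun j => ?_⟩
    rcases min_choice (y j + η * (x j - d j)) 0 with h | h <;> rw [hmin j] at h
    · have : η * (x j - d j) = 0 := by linarith
      rw [(mul_eq_zero.1 this).resolve_left hη.ne', mul_zero]
    · rw [h, zero_mul]
  · rintro ⟨h1, h2, h3⟩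
    ext j
    rw [hj]
    rcases mul_eq_zero.1 (h3 j) with h | h
    · rw [h, zero_add]
      exact min_eq_right (mul_nonneg hη.le (sub_nonneg.2 (h2 j)))
    · rw [h, mul_zero, add_zero, min_eq_left (h1 j)]

theorem softThreshold_eq_iff {τ β : ℝ} (hτ : 0 ≤ τ) (hβ : 0 < β)
    (x v : EuclideanSpace ℝ (Var N)) : softThreshold N (β * τ) x = v ↔
      ∀ a, inner ℝ (x - v) (a - v) ≤ β * (gFun N τ a - gFun N τ v) := by
  constructor
  · rintro rfl a
    exact inner_softThreshold_le N hτ hβ x a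
  · intro h
    rw [← prox_gFun N hτ hβ]
    refine prox_eq_of_variational (fun u => EReal.coe_ne_bot _) rfl fun u b hb => ?_
    rw [← EReal.coe_eq_coe_iff.1 hb, ← mul_sub]
    exact h u

/-- The fixed points of the primal-dual operator are the pairs of a solution and a multiplier. -/
theorem fixedPoint_iff_isMultiplier {n : Type*} [Fintype n] {τ β η : ℝ}
    (hτ : 0 ≤ τ) (hβ : 0 < β) (hη : 0 < η) (D : Matrix n (Var N) ℝ) (d : n → ℝ)
    (v : EuclideanSpace ℝ (Var N)) (y : EuclideanSpace ℝ n) :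
    (softThreshold N (β * τ) (v - β • app Dᵀ y - β • fGrad R v) = v ∧
      dualProx d η (y + η • app D v) = y) ↔ v ∈ feasibleSet D d ∧ IsMultiplier R τ D d v y := by
  rw [softThreshold_eq_iff hτ hβ, dualProx_eq_self_iff d hη]
  have h : ∀ a, inner ℝ (v - β • app Dᵀ y - β • fGrad R v - v) (a - v) ≤
      β * (gFun N τ a - gFun N τ v) ↔ 0 ≤ inner ℝ (fGrad R v) (a - v) +
        inner ℝ (app D (a - v)) y + (gFun N τ a - gFun N τ v) := by
    intro a
    have h1 : v - β • app Dᵀ y - β • fGrad R v - v = -(β • (app Dᵀ y + fGrad R v)) := by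
      module
    rw [h1, inner_neg_left, real_inner_smul_left, inner_add_left, inner_app_transpose,
      ← mul_neg, mul_le_mul_iff_right₀ hβ, ← sub_nonneg]
    ring_nf
  simp only [h]
  constructor
  · rintro ⟨h1, h2, h3, h4⟩
    exact ⟨h3, h2, h4, h1⟩
  · rintro ⟨h3, h2, h4, h1⟩
    exact ⟨h1, h2, h3, h4⟩

end Portfolio

/-! ### Momentum and step size parameters -/

theorem theta_mem_Icc {ϱ δ : ℝ} (hδ : 0 < δ) (k : ℕ) :
    theta ϱ δ k ∈ Set.Icc (min ϱ 0) (max ϱ 0) := by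
  have hk : 0 < (k : ℝ) + δ := by positivity
  have h0 : 0 ≤ (k : ℝ) / (k + δ) := by positivity
  have h1 : (k : ℝ) / (k + δ) ≤ 1 := by
    rw [div_le_one hk]
    linarith
  rw [theta, mul_div_assoc, Set.mem_Icc]
  rcases le_total ϱ 0 with h | h
  · rw [min_eq_left h, max_eq_right h]
    constructor <;> nlinarith
  · rw [min_eq_right h, max_eq_left h]
    constructor <;> nlinarith

/-- Clear the denominator in the bound on `η`, drop the positive term `η L (2ξ - βL)` and cancel
`2ξ`: what remains is `2ξβησ² < 2ξ - βL`, the claim multiplied by `β`. -/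
theorem lipschitz_lt_of_stepsize_lt {L ξ β η σ : ℝ} (hL : 0 < L) (hξ : 0 < ξ)
    (hβ : β ∈ Set.Ioo 0 (2 * ξ / L))
    (hη : η ∈ Set.Ioo 0 (2 * ξ * (2 * ξ - β * L) /
      (4 * β * ξ ^ 2 * σ ^ 2 + L * (2 * ξ - β * L)))) :
    L < 2 * ξ * (1 / β - η * σ ^ 2) := by
  obtain ⟨hβ0, hβ1⟩ := hβ
  obtain ⟨hη0, hη1⟩ := hη
  rw [lt_div_iff₀ hL] at hβ1
  have hgap : 0 < 2 * ξ - β * L := by linarith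
  rw [lt_div_iff₀ (by positivity)] at hη1
  have h1 : 0 < η * (L * (2 * ξ - β * L)) := by positivity
  have h2 : 2 * ξ * (2 * ξ * β * (η * σ ^ 2)) < 2 * ξ * (2 * ξ - β * L) := by nlinarith
  have h3 := lt_of_mul_lt_mul_left h2 (by positivity)
  have h4 : 2 * ξ * (1 / β - η * σ ^ 2) = (2 * ξ - 2 * ξ * β * (η * σ ^ 2)) / β := by
    field_simp
  rw [h4, lt_div_iff₀ hβ0]
  linarith

end KMPA

/-! ### The convergence theorem -/

theorem mainTheorem1
    {T N : ℕ} (hT : 0 < T) (R : Matrix (Fin T) (Fin N) ℝ)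
    (τ ρ₁ ρ₂ : ℝ) (hτ : 0 ≤ τ) (hρ₁ : 0 < ρ₁) (hρ₂ : 0 < ρ₂)
    (hfeas : (KMPA.feasibleSet (KMPA.matD R) (KMPA.vecd ρ₁ ρ₂)).Nonempty)
    (ϱ δ : ℝ) (hϱ : ϱ ∈ Set.Ioo (-1 : ℝ) 1) (hδ : 0 < δ)
    (L : ℝ) (hL : 0 < L)
    (hLip : ∀ x y : EuclideanSpace ℝ (KMPA.Var N),
      ‖gradient (KMPA.fFun R) x - gradient (KMPA.fFun R) y‖ ≤ L * ‖x - y‖)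
    (ξ : ℝ) (hξ : ξ = 1 - max ϱ 0)
    (β : ℝ) (hβ : β ∈ Set.Ioo 0 (2 * ξ / L))
    (η : ℝ)
    (hη : η ∈ Set.Ioo 0 (2 * ξ * (2 * ξ - β * L) /
      (4 * β * ξ ^ 2 * KMPA.specNorm (KMPA.matD R) ^ 2 + L * (2 * ξ - β * L))))
    (z : ℕ → EuclideanSpace ℝ (KMPA.Var N ⊕ KMPA.Con))
    (hz : ∀ k, z (k + 1) =
      KMPA.opTW (KMPA.fFun R) (KMPA.gFun N τ) (KMPA.matD R) (KMPA.vecd ρ₁ ρ₂) β η (z k) +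
        KMPA.theta ϱ δ k •
          (KMPA.opTW (KMPA.fFun R) (KMPA.gFun N τ) (KMPA.matD R) (KMPA.vecd ρ₁ ρ₂) β η (z k) -
            z k)) :
    ∃ v : EuclideanSpace ℝ (KMPA.Var N),
      KMPA.IsSolution (fun u => KMPA.fFun R u + KMPA.gFun N τ u) (KMPA.matD R)
        (KMPA.vecd ρ₁ ρ₂) v ∧
      Tendsto (fun k => KMPA.fstBlock (z k)) atTop (𝓝 v) := by

  obtain ⟨hϱ0, hϱ1⟩ := hϱ
  have hξ0 : 0 < ξ := by
    rw [hξ, sub_pos]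
    exact max_lt hϱ1 one_pos
  have hcond := KMPA.lipschitz_lt_of_stepsize_lt hL hξ0 hβ hη
  obtain ⟨hβ0, -⟩ := hβ
  obtain ⟨hη0, -⟩ := hη
  have hpos : η * KMPA.specNorm (KMPA.matD R) ^ 2 < 1 / β := by
    have := pos_of_mul_pos_right (hL.trans hcond) (by positivity)
    linarith
  set D := KMPA.matD R
  set d := KMPA.vecd ρ₁ ρ₂
  set T' : EuclideanSpace ℝ (KMPA.Var N) × EuclideanSpace ℝ KMPA.Con →
      EuclideanSpace ℝ (KMPA.Var N) × EuclideanSpace ℝ KMPA.Con := fun p =>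
    KMPA.blocks (KMPA.opTW (KMPA.fFun R) (KMPA.gFun N τ) D d β η (KMPA.blocks.symm p)) with hT'
  have hop := fun p : EuclideanSpace ℝ (KMPA.Var N) × EuclideanSpace ℝ KMPA.Con =>
    KMPA.opTW_blocks (g := KMPA.gFun N τ) D d hβ0 hη0 hpos (KMPA.blocks.symm p)
      (KMPA.hasGradientAt_fGrad R _)
  simp only [KMPA.prox_gFun N hτ hβ0, KMPA.prox_conj_iota d hη0] at hop
  have hT₁ : ∀ p, (T' p).1 =
      KMPA.softThreshold N (β * τ) (p.1 - β • KMPA.appL Dᵀ p.2 - β • KMPA.fGrad R p.1) :=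
    fun p => (hop p).1
  have hT₂ : ∀ p, (T' p).2 =
      KMPA.dualProx d η (p.2 + η • KMPA.appL D ((2 : ℝ) • (T' p).1 - p.1)) :=
    fun p => (hop p).2
  have hfix : ∀ p, T' p = p ↔ p.1 ∈ KMPA.feasibleSet D d ∧
      KMPA.IsMultiplier R τ D d p.1 p.2 := by
    intro p
    rw [← KMPA.fixedPoint_iff_isMultiplier R hτ hβ0 hη0 D d]
    -- At a fixed point the extrapolation is trivial, so the two blocks decouple into the optimality
    -- conditions.
    have h2 : (2 : ℝ) • p.1 - p.1 = p.1 := by module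
    constructor
    · intro h
      have h₁ := hT₁ p
      have h₂ := hT₂ p
      rw [h, h2] at h₂
      rw [h] at h₁
      exact ⟨h₁.symm, h₂.symm⟩
    · rintro ⟨h₁, h₂⟩
      have h₁' : (T' p).1 = p.1 := (hT₁ p).trans h₁
      refine Prod.ext h₁' ?_
      rw [hT₂, h₁', h2]
      exact h₂
  obtain ⟨v₀, hv₀⟩ := KMPA.exists_isSolution R hT hτ D d hfeas
  obtain ⟨y₀, hy₀⟩ := KMPA.exists_isMultiplier R hτ D d hv₀
  -- The update is the relaxation `z + (1 + θ_k)(T z - z)`. The lower bound `1 + min ϱ 0` is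
  -- positive since `ϱ > -1`, and the upper bound `1 + max ϱ 0` equals `2 - ξ`.
  obtain ⟨p, hp, hlim⟩ := KMPA.primalDual_tendsto (KMPA.appL D) (KMPA.appL Dᵀ)
    (KMPA.inner_app_transpose D) hβ0 hη0 hL hξ0 (a := 1 + min ϱ 0)
    (by linarith [lt_min hϱ0 neg_one_lt_zero]) hcond (KMPA.fGrad R) (KMPA.fGrad R).continuous
    (KMPA.norm_fGrad_sq_le R hL hLip) (KMPA.gFun N τ) (KMPA.softThreshold N (β * τ))
    (KMPA.continuous_softThreshold N _) (KMPA.inner_softThreshold_le N hτ hβ0)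
    {y | ∀ j, y j ≤ 0} (fun y => inner ℝ y (WithLp.toLp 2 d)) (KMPA.dualProx d η)
    (KMPA.continuous_dualProx d η) (KMPA.dualProx_nonpos d η) (KMPA.inner_dualProx_le d η)
    T' hT₁ hT₂ (v₀, y₀) ((hfix _).2 ⟨hv₀.1, hy₀⟩) (fun k => 1 + KMPA.theta ϱ δ k)
    (fun k => by linarith [(KMPA.theta_mem_Icc (ϱ := ϱ) hδ k).1])
    (fun k => by linarith [(KMPA.theta_mem_Icc (ϱ := ϱ) hδ k).2])
    (fun k => KMPA.blocks (z k)) (fun k => by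
      simp only [hT', ContinuousLinearEquiv.symm_apply_apply]
      rw [hz k, map_add, map_smul, map_sub]
      module)
  obtain ⟨hpf, hpm⟩ := (hfix p).1 hp
  exact ⟨p.1, KMPA.isSolution_of_isMultiplier R D d hpf hpm,
    (continuous_fst.tendsto p).comp hlim⟩
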